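/- Let $N\cong\mathbb Z^d$ be a lattice with real vector space $N_{\mathbb R}=N\otimes_{\mathbb Z}\mathbb R\cong\mathbb R^d$. A polytope $P\subset N_{\mathbb R}$ is called a ($d$-dimensional) smooth Fano polytope if its vertices lie in $N$, the origin is an interior point of $P$, and the vertex set of every facet of $P$ is a basis of the lattice $N$. (For $d=0$ this is the point $\{0\}$.) Two smooth Fano polytopes $P\subset N_{\mathbb R}$ and $P'\subset N'_{\mathbb R}$ are lattice equivalent if there is an affine-linear isomorphism $N_{\mathbb R}\to N'_{\mathbb R}$ that maps $N$ onto $N'$ and the vertex set of $P$ onto the vertex set of $P'$. The direct sum of $Q\subset N_{\mathbb R}$ and $Q'\subset N'_{\mathbb R}$ is $Q\oplus Q'=\operatorname{conv}(Q\times\{0\}\cup\{0\}\times Q')\subset N_{\mathbb R}\times N'_{\mathbb R}$, with respect to the lattice $N\times N'$; $Q^{\oplus m}$ denotes the $m$-fold direct sum. Let $P_6=\operatorname{conv}\{\pm e_1,\ \pm e_2,\ \pm(e_1-e_2)\}\subset\mathbb R^2$, with respect to the lattice $\mathbb Z^2$. **Theorem.** Let $d,k\ge 0$ be integers with $d\ge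 15k^2+37k+2$, and let $P$ be a $d$-dimensional smooth Fano polytope with exactly $3d-k$ vertices. Let $$f(d,k):=\left\lfloor\frac{d-15k^2-37k}{2}\right\rfloor .$$ Then there is a smooth Fano polytope $Q$ of dimension $d-2f(d,k)$ such that $P$ is lattice equivalent to $$Q\oplus P_6^{\oplus f(d,k)} .$$ -/

import Mathlib

/-- The standard lattice `ℤⁿ` in `ℝⁿ`. -/
def stdLattice (n : ℕ) : Submodule ℤ (Fin n → ℝ) :=
  Submodule.span ℤ (Set.range (Pi.basisFun ℝ (Fin n)))

/-- `F` is a facet of the polytope `P`: a (nonempty, exposed) face of `P` of codimension one.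
A zero-dimensional polytope has no facets in this sense. -/
def IsFacet {V : Type*} [NormedAddCommGroup V] [NormedSpace ℝ V] (P F : Set V) : Prop :=
  IsExposed ℝ P F ∧ F.Nonempty ∧
    Module.finrank ℝ (vectorSpan ℝ F) + 1 = Module.finrank ℝ (vectorSpan ℝ P)

/-- `P` is a smooth Fano polytope with respect to the lattice `N` of `V`. The vertices of a polytope
are its extreme points. Having `0` in its interior, `P` is full-dimensional, i.e. its dimension is
the dimension of `V`. -/
structure IsSmoothFano {V : Type*} [NormedAddCommGroup V] [NormedSpace ℝ V]
    (N : Submodule ℤ V) (P : Set V) : Prop where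
  /-- `P` is a polytope. -/
  polytope : ∃ S : Finset V, P = convexHull ℝ (S : Set V)
  /-- The vertices of `P` are lattice points. -/
  lattice : ∀ v ∈ P.extremePoints ℝ, v ∈ N
  /-- The origin is an interior point of `P`. -/
  zero_mem_interior : (0 : V) ∈ interior P
  /-- The vertex set of every facet is a basis of the lattice. -/
  facet_basis : ∀ F : Set V, IsFacet P F →
    ∃ b : Module.Basis (Fin (Module.finrank ℝ V)) ℤ N,
      Set.range (fun i => (b i : V)) = F.extremePoints ℝ

/-- Lattice equivalence: an affine-linear isomorphism of the ambient spaces that maps the one lattice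
onto the other maps the vertex set of `P` onto the vertex set of `P'`. -/
def LatticeEquivalent {V W : Type*} [NormedAddCommGroup V] [NormedSpace ℝ V]
    [NormedAddCommGroup W] [NormedSpace ℝ W] (N : Submodule ℤ V) (N' : Submodule ℤ W)
    (P : Set V) (P' : Set W) : Prop :=
  ∃ φ : V ≃ᵃ[ℝ] W, φ '' (N : Set V) = (N' : Set W) ∧
    φ '' P.extremePoints ℝ = P'.extremePoints ℝ

/-- The direct sum (free sum) `Q ⊕ Q'` of polytopes containing the origin; it lives in the product
space, whose lattice is the product lattice `N.prod N'`. -/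
def freeSum {V W : Type*} [NormedAddCommGroup V] [NormedSpace ℝ V]
    [NormedAddCommGroup W] [NormedSpace ℝ W] (Q : Set V) (Q' : Set W) : Set (V × W) :=
  convexHull ℝ (Q ×ˢ {0} ∪ {0} ×ˢ Q')

/-- The `m`-fold direct sum `Q ⊕ ⋯ ⊕ Q` of a polytope containing the origin: the convex hull of the
copies of `Q` in the `m` coordinate subspaces of `V ^ m` (for `m = 0`, the point `0`). -/
def freePow {V : Type*} [NormedAddCommGroup V] [NormedSpace ℝ V] (Q : Set V) (m : ℕ) :
    Set (Fin m → V) :=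
  convexHull ℝ ({0} ∪ ⋃ i : Fin m, (fun q : V => (Pi.single i q : Fin m → V)) '' Q)

/-- The product lattice `N ^ m` in `V ^ m`. -/
def latticePow {V : Type*} [NormedAddCommGroup V] [NormedSpace ℝ V] (N : Submodule ℤ V) (m : ℕ) :
    Submodule ℤ (Fin m → V) :=
  Submodule.pi Set.univ (fun _ => N)

/-- The hexagon `P₆`, a smooth Fano polygon with respect to `ℤ²`. -/
def hexagon : Set (Fin 2 → ℝ) :=
  convexHull ℝ {![1, 0], ![0, 1], ![-1, 1], ![-1, 0], ![0, -1], ![1, -1]}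

/-- The number `⌊(d - 15k² - 37k) / 2⌋` of hexagons; it is only used for `d ≥ 15k² + 37k + 2`, where
it is positive, so that the natural-number floor is the floor. -/
def splitNumber (d k : ℕ) : ℕ :=
  ⌊((d : ℚ) - 15 * (k : ℚ) ^ 2 - 37 * (k : ℚ)) / 2⌋₊

/-!
Fix a facet of `P` with vertices `b 1, ..., b d`, a lattice basis, and call the sum of the
coordinates of a lattice point in this basis its height. All vertices of `P` other than the `b i`
have height at most `0`. Choose the facet such that its cone contains the sum of all vertices
(`exists_isFacetBasis_repr_nonneg`); then the sum of all heights is nonnegative. Smoothness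
implies that a vertex of height `0` with a negative `i`-th coordinate is the new vertex of the
facet across the `i`-th ridge. So there are at most `d` vertices of height `0`, there are `d` of
height `1`, and by the choice of the facet at most `d` of negative height. If there are `3d - k`
vertices, then, with few exceptions,

* each index `i` has a vertex `b (φ i) - b i` of height `0`, and
* the negative vertices have height `-1`.

For two vertices of height `0` with distinct negative supports there is no vertex of height `-1`
that is negative in both supports (`IsFacetBasis.eq_of_repr_neg`): after the exchange of one basis
vector, it would compete with a vertex of height `0` for the exchange of the other. Hence almost
all vertices of height `-1` are of the form `-b i`. Competition for an exchange also forces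
`φ (φ i) = i` whenever `-b i` is a vertex and `φ i` is not exceptional
(`IsFacetBasis.eq_of_sub_mem_of_neg_mem`). Thus almost all indices come in pairs `i`, `φ i`, and
`±b i`, `±b (φ i)`, `±(b i - b (φ i))` are the vertices of a hexagon.

It remains to count the indices at which one of the exceptional vertices has a nonzero coordinate.
The exceptional vertices of height `-1` are counted through their negative coordinates at indices
`i` without a vertex `b j - b i`. At the other indices, a vertex of height `-m` has at most `3m + 1`
negative coordinates, since it rises with each of several independent exchanges
(`IsFacetBasis.card_le_of_repr_neg`). Altogether, at most `15k² + 37k` indices do not belong to a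
hexagon that is met by no other vertex (`exists_hexagon_pairs`).

Geometry enters in the existence of facets and of adjacent facets, both by linear programming, and
at the end: the complementary summand `Q` is the image of `P` under the projection that forgets
the hexagons. A facet of `Q`, with an edge of each hexagon, spans a facet of `P`, so `Q` is smooth
(`isSmoothFano_image_fst`).
-/

/-! ### Facets and exchanges -/

namespace SmoothFano

open Module Finset

section Facets

variable {ι N : Type*} [AddCommGroup N]

/-- The sum of the coordinates with respect to a lattice basis `b`. If `b` is the vertex set of a
facet, this is the linear functional that takes the value `1` on the facet. -/
noncomputable def height [Fintype ι] (b : Basis ι ℤ N) : N →ₗ[ℤ] ℤ := ∑ i, b.coord i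

lemma height_apply [Fintype ι] (b : Basis ι ℤ N) (x : N) : height b x = ∑ i, b.repr x i := by
  simp [height]

@[simp] lemma height_basis [Fintype ι] (b : Basis ι ℤ N) (i : ι) : height b (b i) = 1 := by
  classical simp [height_apply, Finsupp.single_apply]

/-- The lattice basis `b` is the vertex set of a facet of the polytope with vertex set `X`:
its members belong to `X`, and all the other points of `X` have height less than `1`. -/
structure IsFacetBasis [Fintype ι] (X : Finset N) (b : Basis ι ℤ N) : Prop where
  mem : ∀ i, b i ∈ X
  height_le : ∀ x ∈ X, height b x ≤ 1
  eq_of_height : ∀ x ∈ X, height b x = 1 → ∃ i, b i = x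

/-- The basis `b'` arises from `b` by replacing the `i`-th member with a vector on the other side of
the hyperplane spanned by the remaining ones. -/
structure IsExchange (b b' : Basis ι ℤ N) (i : ι) : Prop where
  eq_of_ne : ∀ j, j ≠ i → b' j = b j
  repr_self : b.repr (b' i) i = -1

/-- The combinatorial trace of smoothness: `X` does not contain the origin, and from each facet one
can pass to the adjacent facet across each of its ridges. -/
structure IsFanoSystem (ι : Type*) {N : Type*} [Fintype ι] [AddCommGroup N] (X : Finset N) :
    Prop where
  zero_notMem : (0 : N) ∉ X
  exists_exchange : ∀ b : Basis ι ℤ N, IsFacetBasis X b → ∀ i, ∃ b' : Basis ι ℤ N,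
    IsFacetBasis X b' ∧ IsExchange b b' i

namespace IsExchange

variable {b b' : Basis ι ℤ N} {i : ι}

lemma repr_same (h : IsExchange b b' i) (x : N) : b'.repr x i = -b.repr x i := by
  have : b'.coord i = -b.coord i := by
    refine b'.ext fun k => ?_
    by_cases hk : k = i
    · subst hk; simp [h.repr_self]
    · rw [Basis.coord_apply, b'.repr_self, h.eq_of_ne k hk]; simp [hk]
  simpa using congrArg (fun f => f x) this

lemma repr_ne (h : IsExchange b b' i) (x : N) {j : ι} (hj : j ≠ i) :
    b'.repr x j = b.repr x j + b.repr x i * b.repr (b' i) j := by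
  have : b'.coord j = b.coord j + b.repr (b' i) j • b.coord i := by
    refine b'.ext fun k => ?_
    by_cases hk : k = i
    · subst hk; simp [h.repr_self, Ne.symm hj]
    · have h1 : b'.coord j (b' k) = b.coord j (b k) := by classical simp [Finsupp.single_apply]
      rw [h1, h.eq_of_ne k hk]; simp [hk]
  have := congrArg (fun f => f x) this
  simp only [LinearMap.add_apply, LinearMap.smul_apply, Basis.coord_apply, smul_eq_mul] at this
  rw [this]; ring

lemma height_eq [Fintype ι] (h : IsExchange b b' i) (x : N) :
    height b' x = height b x + b.repr x i * (height b (b' i) - 1) := by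
  have : height b' = height b + (height b (b' i) - 1) • b.coord i := by
    refine b'.ext fun k => ?_
    by_cases hk : k = i
    · subst hk; simp [h.repr_self]
    · rw [height_basis, h.eq_of_ne k hk]; simp [hk]
  have := congrArg (fun f => f x) this
  simp only [LinearMap.add_apply, LinearMap.smul_apply, Basis.coord_apply, smul_eq_mul] at this
  rw [this]; ring

end IsExchange

lemma repr_basis_nonneg (b : Basis ι ℤ N) (i j : ι) : 0 ≤ b.repr (b i) j := by
  classical
  rw [b.repr_self, Finsupp.single_apply]; split_ifs <;> norm_num

lemma repr_sub_basis [DecidableEq ι] (b : Basis ι ℤ N) (i j k : ι) :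
    b.repr (b j - b i) k = (if j = k then 1 else 0) - (if i = k then 1 else 0) := by
  simp [Finsupp.single_apply]

variable [Fintype ι]

lemma eq_zero_of_height_eq_zero (b : Basis ι ℤ N) {x : N} (hx : ∀ i, 0 ≤ b.repr x i)
    (h : height b x = 0) : x = 0 := by
  rw [height_apply, Finset.sum_eq_zero_iff_of_nonneg (fun i _ => hx i)] at h
  apply b.ext_elem
  intro i
  simpa using h i (mem_univ i)

lemma exists_eq_basis_of_height_eq_one (b : Basis ι ℤ N) {x : N} (hx : ∀ i, 0 ≤ b.repr x i)
    (h : height b x = 1) : ∃ i, x = b i := by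
  obtain ⟨i, hi⟩ : ∃ i, 0 < b.repr x i := by
    by_contra! hcon
    have : height b x ≤ 0 := by
      rw [height_apply]; exact Finset.sum_nonpos fun i _ => hcon i
    omega
  refine ⟨i, sub_eq_zero.1 (eq_zero_of_height_eq_zero b (fun j => ?_) (by simp [h]))⟩
  have := hx j
  by_cases hij : i = j
  · subst hij; simp; omega
  · simpa [hij] using this

/-- A vector of height `0` whose only negative coordinate is a `-1`. -/
lemma exists_eq_sub_of_height_eq_zero (b : Basis ι ℤ N) {x : N} {i : ι}
    (hi : b.repr x i = -1) (hx : ∀ j, j ≠ i → 0 ≤ b.repr x j) (h : height b x = 0) :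
    ∃ j, x = b j - b i := by
  obtain ⟨j, hj⟩ := exists_eq_basis_of_height_eq_one b (x := x + b i) (fun j => by
    by_cases hij : i = j
    · subst hij; simp [hi]
    · simpa [hij] using hx j (Ne.symm hij)) (by simp [h])
  exact ⟨j, eq_sub_of_add_eq hj⟩

/-- A vector of height `-1` whose only negative coordinate is a `-1`. -/
lemma eq_neg_of_height_eq_neg_one (b : Basis ι ℤ N) {x : N} {i : ι}
    (hi : b.repr x i = -1) (hx : ∀ j, j ≠ i → 0 ≤ b.repr x j) (h : height b x = -1) :
    x = -b i := by
  refine eq_neg_of_add_eq_zero_left (eq_zero_of_height_eq_zero b (fun j => ?_) (by simp [h]))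
  by_cases hij : i = j
  · subst hij; simp [hi]
  · simpa [hij] using hx j (Ne.symm hij)

variable {X : Finset N} {b : Basis ι ℤ N}

namespace IsFacetBasis

lemma height_nonpos_of_repr_neg (hb : IsFacetBasis X b) {x : N} (hx : x ∈ X) {i : ι}
    (hi : b.repr x i < 0) : height b x ≤ 0 := by
  have h1 := hb.height_le x hx
  by_contra h
  obtain ⟨j, rfl⟩ := hb.eq_of_height x hx (by omega)
  exact absurd (repr_basis_nonneg b j i) (by omega)

/-- A vertex of height `≤ 0` that lies on the facet across the `i`-th ridge is the new vertex. -/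
lemma eq_of_exchange {b' : Basis ι ℤ N} {i : ι} (hb' : IsFacetBasis X b')
    (h : IsExchange b b' i) {x : N} (hx : x ∈ X) (hx0 : height b x ≤ 0)
    (h1 : height b' x = 1) : x = b' i := by
  obtain ⟨j, rfl⟩ := hb'.eq_of_height x hx h1
  by_cases hj : j = i
  · rw [hj]
  · rw [h.eq_of_ne j hj, height_basis] at hx0; omega

/-- A vertex `x` of height `0` with a negative `i`-th coordinate is the vertex that is exchanged for
`b i` across the `i`-th ridge. -/
lemma exists_exchange_of_height_eq_zero (hX : IsFanoSystem ι X) (hb : IsFacetBasis X b) {x : N}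
    (hx : x ∈ X) (h0 : height b x = 0) {i : ι} (hi : b.repr x i < 0) :
    ∃ b' : Basis ι ℤ N, IsFacetBasis X b' ∧ IsExchange b b' i ∧ b' i = x := by
  obtain ⟨b', hb', h⟩ := hX.exists_exchange b hb i
  refine ⟨b', hb', h, (eq_of_exchange hb' h hx h0.le ?_).symm⟩
  have h1 := hb.height_nonpos_of_repr_neg (hb'.mem i) (i := i) (by rw [h.repr_self]; norm_num)
  have h2 := hb'.height_le x hx
  rw [h.height_eq x, h0] at h2 ⊢
  nlinarith

lemma repr_eq_neg_one (hX : IsFanoSystem ι X) (hb : IsFacetBasis X b) {x : N}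
    (hx : x ∈ X) (h0 : height b x = 0) {i : ι} (hi : b.repr x i < 0) : b.repr x i = -1 := by
  obtain ⟨b', -, h, rfl⟩ := hb.exists_exchange_of_height_eq_zero hX hx h0 hi
  exact h.repr_self

/-- Vertices of height `0` have disjoint negative supports. -/
lemma eq_of_height_eq_zero (hX : IsFanoSystem ι X) (hb : IsFacetBasis X b) {x y : N}
    (hx : x ∈ X) (hy : y ∈ X) (hx0 : height b x = 0) (hy0 : height b y = 0) {i : ι}
    (hxi : b.repr x i < 0) (hyi : b.repr y i < 0) : x = y := by
  obtain ⟨b', hb', h, rfl⟩ := hb.exists_exchange_of_height_eq_zero hX hx hx0 hxi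
  refine (eq_of_exchange hb' h hy hy0.le ?_).symm
  have h2 := hb'.height_le y hy
  rw [h.height_eq y, hy0, hx0] at h2 ⊢
  omega

lemma height_le_repr (hX : IsFanoSystem ι X) (hb : IsFacetBasis X b) {x : N}
    (hx : x ∈ X) (h0 : height b x < 0) (i : ι) : height b x ≤ b.repr x i := by
  by_contra! hi
  obtain ⟨b', hb', h⟩ := hX.exists_exchange b hb i
  have h1 := hb.height_nonpos_of_repr_neg (hb'.mem i) (i := i) (by rw [h.repr_self]; norm_num)
  have h2 := hb'.height_le x hx
  have h3 : height b' x ≠ 1 := fun h3 => by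
    have := eq_of_exchange hb' h hx h0.le h3
    rw [this, h.repr_self] at hi
    rw [this] at h0
    omega
  rw [h.height_eq x] at h2 h3
  have : b.repr x i * (height b (b' i) - 1) ≥ -b.repr x i := by nlinarith
  omega

/-- If no vertex of height `0` is negative at `i`, then at most one vertex of height `-1` is. -/
lemma eq_of_height_eq_neg_one (hX : IsFanoSystem ι X) (hb : IsFacetBasis X b) {i : ι}
    (hi : ∀ w ∈ X, height b w = 0 → 0 ≤ b.repr w i) {x y : N} (hx : x ∈ X) (hy : y ∈ X)
    (hx0 : height b x = -1) (hy0 : height b y = -1)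
    (hxi : b.repr x i < 0) (hyi : b.repr y i < 0) : x = y := by
  obtain ⟨b', hb', h⟩ := hX.exists_exchange b hb i
  have h1 := hb.height_nonpos_of_repr_neg (hb'.mem i) (i := i) (by rw [h.repr_self]; norm_num)
  have h1' : height b (b' i) ≠ 0 := fun h0 => by
    have := hi _ (hb'.mem i) h0
    rw [h.repr_self] at this; omega
  have key : ∀ z ∈ X, height b z = -1 → b.repr z i < 0 → z = b' i := fun z hz hz0 hzi => by
    refine eq_of_exchange hb' h hz (by omega) ?_
    have h2 := hb'.height_le z hz
    rw [h.height_eq z, hz0] at h2 ⊢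
    have : height b (b' i) - 1 ≤ -2 := by omega
    nlinarith
  rw [key x hx hx0 hxi, key y hy hy0 hyi]

/-- The negative coordinates of a vertex of height `-1` belong to the negative support of a single
vertex of height `0`, apart from those at which no vertex of height `0` is negative. -/
lemma eq_of_repr_neg (hX : IsFanoSystem ι X) (hb : IsFacetBasis X b) {x v w : N} {i j : ι}
    (hx : x ∈ X) (hv : v ∈ X) (hw : w ∈ X) (hx1 : height b x = -1) (hv0 : height b v = 0)
    (hw0 : height b w = 0) (hxi : b.repr x i < 0) (hxj : b.repr x j < 0)
    (hvi : b.repr v i < 0) (hwj : b.repr w j < 0) : v = w := by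
  by_cases hij : i = j
  · subst hij; exact hb.eq_of_height_eq_zero hX hv hw hv0 hw0 hvi hwj
  have hxi' := hb.height_le_repr hX hx (by omega) i
  have hxj' := hb.height_le_repr hX hx (by omega) j
  -- After the exchange at `i`, the vertex `x` has height `0`; hence `v` is not positive at `j`.
  obtain ⟨b', hb', h, rfl⟩ := hb.exists_exchange_of_height_eq_zero hX hv hv0 hvi
  obtain ⟨b'', hb'', h', rfl⟩ := hb.exists_exchange_of_height_eq_zero hX hw hw0 hwj
  have e1 := h.height_eq x
  have e2 := h'.height_eq x
  rw [hv0, hx1, show b.repr x i = -1 by omega] at e1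
  rw [hw0, hx1, show b.repr x j = -1 by omega] at e2
  have r1 := h.repr_ne x (Ne.symm hij)
  have r2 := h'.repr_ne x hij
  rw [show b.repr x i = -1 by omega, show b.repr x j = -1 by omega] at r1 r2
  rcases lt_trichotomy (b.repr (b' i) j) 0 with hj | hj | hj
  · exact hb.eq_of_height_eq_zero hX hv hw hv0 hw0 hj hwj
  · rcases lt_trichotomy (b.repr (b'' j) i) 0 with hi | hi | hi
    · exact hb.eq_of_height_eq_zero hX hv hw hv0 hw0 hvi hi
    · -- Both `x` and `b'' j` are now exchanged for `b j`.
      exfalso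
      have e3 := h.height_eq (b'' j)
      have r3 := h.repr_ne (b'' j) (Ne.symm hij)
      rw [hw0, hi, hv0] at e3
      rw [hi] at r3
      have := hb'.eq_of_height_eq_zero hX hx hw (by omega) (by omega) (i := j) (by omega)
        (by omega)
      rw [this] at hx1; omega
    · have := hb''.repr_eq_neg_one hX hx (by omega) (i := i) (by omega)
      omega
  · have := hb'.repr_eq_neg_one hX hx (by omega) (i := j) (by omega)
    omega

end IsFacetBasis

end Facets

end SmoothFano

/-! ### Sequences of exchanges -/

namespace SmoothFano

open Module Finset

section Facets

variable {ι N : Type*} [AddCommGroup N] [Fintype ι] {X : Finset N} {b : Basis ι ℤ N}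

lemma IsFanoSystem.ne_of_sub_mem (hX : IsFanoSystem ι X) {i j : ι} (h : b j - b i ∈ X) : j ≠ i := by
  rintro rfl
  exact hX.zero_notMem (by simpa using h)

lemma height_sub_basis (b : Basis ι ℤ N) (i j : ι) : height b (b j - b i) = 0 := by simp

namespace IsFacetBasis

/-- A vertex that lies `m` levels below the facet has at most `3m + 1` negative coordinates among
those at which a vertex of the form `b j - b i` is available: one may exchange a third of them
independently of each other, and every exchange raises the height of the vertex. -/
lemma card_le_of_repr_neg (hX : IsFanoSystem ι X) (φ : ι → ι) (S : Finset ι) :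
    ∀ b : Basis ι ℤ N, IsFacetBasis X b → (∀ i ∈ S, b (φ i) - b i ∈ X) → ∀ x ∈ X,
      height b x ≤ 0 → (∀ i ∈ S, b.repr x i < 0) → (#S : ℤ) ≤ 3 * -height b x + 1 := by
  classical
  induction S using Finset.strongInduction with
  | H S ih =>
  intro b hb hφ x hx hx0 hneg
  rcases S.eq_empty_or_nonempty with rfl | hS
  · simp; omega
  rcases hx0.eq_or_lt with h0 | hlt
  · have : #S ≤ 1 := by
      refine Finset.card_le_one.2 fun i hi j hj => ?_
      by_contra hij
      have e1 := hb.eq_of_height_eq_zero hX hx (hφ i hi) h0 (height_sub_basis b _ _) (hneg i hi)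
        (by rw [repr_sub_basis, if_neg (hX.ne_of_sub_mem (hφ i hi))]; simp)
      have := hneg j hj
      rw [e1, repr_sub_basis, if_neg hij] at this
      split_ifs at this <;> omega
    omega
  -- Some `j ∈ S` is the image of at most one member of `S`.
  obtain ⟨j, hj, hfib⟩ := Finset.exists_card_fiber_le_of_card_le_mul (f := φ) (s := S) (t := S)
    (n := 1) hS (by simp)
  set R : Finset ι := insert j (insert (φ j) {i ∈ S | φ i = j}) with hR
  have hRcard : #R ≤ 3 := by
    have h1 := Finset.card_insert_le j (insert (φ j) {i ∈ S | φ i = j})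
    have h2 := Finset.card_insert_le (φ j) {i ∈ S | φ i = j}
    rw [hR]; omega
  have hcard : #S ≤ #(S \ R) + 3 := by
    have := Finset.card_le_card_sdiff_add_card (s := S) (t := R)
    omega
  obtain ⟨b', hb', h, hw⟩ := hb.exists_exchange_of_height_eq_zero hX (hφ j hj)
    (height_sub_basis b _ _) (i := j)
    (by rw [repr_sub_basis, if_neg (hX.ne_of_sub_mem (hφ j hj))]; simp)
  have hmem : ∀ i ∈ S \ R, i ∈ S ∧ i ≠ j ∧ i ≠ φ j ∧ φ i ≠ j := by
    intro i hi
    simp only [hR, mem_sdiff, mem_insert, mem_filter, not_or, not_and] at hi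
    exact ⟨hi.1, hi.2.1, hi.2.2.1, hi.2.2.2 hi.1⟩
  have hneg' : ∀ i ∈ S \ R, b'.repr x i < 0 := by
    intro i hi
    obtain ⟨hiS, h1, h2, h3⟩ := hmem i hi
    rw [h.repr_ne x h1, hw, repr_sub_basis, if_neg h2.symm, if_neg h1.symm]
    simpa using hneg i hiS
  have hh : height b' x = height b x - b.repr x j := by
    rw [h.height_eq, hw, height_sub_basis]; ring
  have hj' := hneg j hj
  rcases (S \ R).eq_empty_or_nonempty with he | ⟨i, hi⟩
  · rw [he] at hcard; simp at hcard; omega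
  · have hle := hb'.height_nonpos_of_repr_neg hx (hneg' i hi)
    have := ih (S \ R)
      ((Finset.ssubset_iff_of_subset Finset.sdiff_subset).2 ⟨j, hj, by simp [hR]⟩) b' hb'
      (fun i hi => by
        obtain ⟨hiS, h1, h2, h3⟩ := hmem i hi
        rw [h.eq_of_ne i h1, h.eq_of_ne _ h3]; exact hφ i hiS) x hx hle hneg'
    omega

/-- If `-b i` and `b j - b i` are vertices, then so can be `b l - b j` only for `l = i`. -/
lemma eq_of_sub_mem_of_neg_mem (hX : IsFanoSystem ι X) (hb : IsFacetBasis X b) {i j l : ι}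
    (hij : b j - b i ∈ X) (hi : -b i ∈ X) (hjl : b l - b j ∈ X) : l = i := by
  classical
  by_contra hli
  have hji := hX.ne_of_sub_mem hij
  have hlj := hX.ne_of_sub_mem hjl
  obtain ⟨b', hb', h, hw⟩ := hb.exists_exchange_of_height_eq_zero hX hij
    (height_sub_basis b _ _) (i := i) (by simp [hji])
  have h1 : height b' (b l - b j) = 0 := by
    rw [h.height_eq, hw]; simp [hli, hji]
  have h2 : height b' (-b i) = 0 := by rw [h.height_eq, hw]; simp
  have r1 : b'.repr (b l - b j) j = -1 := by
    rw [h.repr_ne _ hji, hw]; simp [hli, hji, hlj]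
  have r2 : b'.repr (-b i) j = -1 := by rw [h.repr_ne _ hji, hw]; simp [hji]
  have := hb'.eq_of_height_eq_zero hX hjl hi (by omega) (by omega) (i := j) (by omega) (by omega)
  have := congrArg (height b) this
  simp at this

/-- If `-b i` and `b j - b i` are vertices, then any other vertex of height `-1` that is negative at
`i` is positive at `j`. -/
lemma repr_pos_of_repr_neg (hX : IsFanoSystem ι X) (hb : IsFacetBasis X b) {i j : ι}
    (hij : b j - b i ∈ X) (hi : -b i ∈ X) {x : N} (hx : x ∈ X) (hx1 : height b x = -1)
    (hxi : b.repr x i < 0) (hne : x ≠ -b i) : 0 < b.repr x j := by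
  classical
  by_contra! hle
  have hji := hX.ne_of_sub_mem hij
  have hxi' := hb.height_le_repr hX hx (by omega) i
  obtain ⟨b', hb', h, hw⟩ := hb.exists_exchange_of_height_eq_zero hX hij
    (height_sub_basis b _ _) (i := i) (by simp [hji])
  have h1 := h.height_eq x
  have h2 : height b' (-b i) = 0 := by rw [h.height_eq, hw]; simp
  have r1 := h.repr_ne x hji
  have r2 : b'.repr (-b i) j = -1 := by rw [h.repr_ne _ hji, hw]; simp [hji]
  rw [hw, height_sub_basis, show b.repr x i = -1 by omega] at h1
  rw [hw, repr_sub_basis, if_pos rfl, if_neg hji.symm, show b.repr x i = -1 by omega] at r1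
  exact hne (hb'.eq_of_height_eq_zero hX hx hi (by omega) (by omega) (i := j) (by omega)
    (by omega))

/-- The index `l` is determined by either of its two partners. -/
lemma eq_of_sub_mem_of_sub_mem (hX : IsFanoSystem ι X) (hb : IsFacetBasis X b) {i j l : ι}
    (hil : b l - b i ∈ X) (hi : -b i ∈ X) (hjl : b l - b j ∈ X) (hj : -b j ∈ X) : i = j := by
  classical
  by_contra hij
  have hli := hX.ne_of_sub_mem hil
  have hlj := hX.ne_of_sub_mem hjl
  have hji : j ≠ i := Ne.symm hij
  -- Exchange at `i` and then at `j`; now `-b i` and `-b j` compete for the exchange at `l`.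
  obtain ⟨b', hb', h, hw⟩ := hb.exists_exchange_of_height_eq_zero hX hil
    (height_sub_basis b _ _) (i := i) (by simp [hli])
  have p1 : height b' (b l - b j) = 0 := by
    rw [h.height_eq, hw]; simp [hji, hli.symm]
  have p2 : b'.repr (b l - b j) j = -1 := by
    rw [h.repr_ne _ hji, hw]; simp [hli, hji, hlj]
  have p3 : b'.repr (b l - b j) l = 1 := by
    rw [h.repr_ne _ hli, hw]; simp [hli, hji, hlj.symm]
  have q1 : height b' (-b i) = 0 := by rw [h.height_eq, hw]; simp
  have q2 : b'.repr (-b i) j = 0 := by rw [h.repr_ne _ hji, hw]; simp [hlj, hij]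
  have q3 : b'.repr (-b i) l = -1 := by rw [h.repr_ne _ hli, hw]; simp [hli.symm]
  have r1 : height b' (-b j) = -1 := by rw [h.height_eq, hw]; simp [hji]
  have r2 : b'.repr (-b j) j = -1 := by rw [h.repr_ne _ hji, hw]; simp [hji]
  have r3 : b'.repr (-b j) l = 0 := by rw [h.repr_ne _ hli, hw]; simp [hlj.symm, hji]
  obtain ⟨b'', hb'', h', hw'⟩ := hb'.exists_exchange_of_height_eq_zero hX hjl
    p1 (i := j) (by omega)
  have s1 : height b'' (-b i) = 0 := by rw [h'.height_eq, hw', q1, q2, p1]; simp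
  have s2 : b''.repr (-b i) l = -1 := by rw [h'.repr_ne _ hlj, hw', q2, q3, p3]; simp
  have t1 : height b'' (-b j) = 0 := by rw [h'.height_eq, hw', r1, r2, p1]; simp
  have t2 : b''.repr (-b j) l = -1 := by rw [h'.repr_ne _ hlj, hw', r2, r3, p3]; simp
  have := hb''.eq_of_height_eq_zero hX hi hj s1 t1 (i := l) (by omega) (by omega)
  exact hij (b.injective (neg_injective this))

end IsFacetBasis

end Facets

end SmoothFano

/-! ### Vertices of height 0 and −1 -/

namespace SmoothFano

open Module Finset

section Counting

open scoped Classical in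
/-- The set of negative coordinates of `x`. -/
noncomputable def negSupp {ι N : Type*} [AddCommGroup N] [Fintype ι] (b : Basis ι ℤ N) (x : N) :
    Finset ι := {i | b.repr x i < 0}

open scoped Classical in
/-- The set of positive coordinates of `x`. -/
noncomputable def posSupp {ι N : Type*} [AddCommGroup N] [Fintype ι] (b : Basis ι ℤ N) (x : N) :
    Finset ι := {i | 0 < b.repr x i}

/-- The points of `X` of height `n`. -/
noncomputable def level {ι N : Type*} [AddCommGroup N] [Fintype ι] (X : Finset N)
    (b : Basis ι ℤ N) (n : ℤ) : Finset N := {x ∈ X | height b x = n}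

open scoped Classical in
/-- The indices at which some point of `X` of height `0` is negative: across the corresponding
ridges, the height of the new vertex is `0`. -/
noncomputable def exitSet {ι N : Type*} [AddCommGroup N] [Fintype ι] (X : Finset N)
    (b : Basis ι ℤ N) : Finset ι := (level X b 0).biUnion (negSupp b)

open scoped Classical in
/-- The indices `i` for which the vertex exchanged for `b i` is of the form `b j - b i`; these
indices are called simple. A point of height `0` is simple if it has a single negative coordinate,
that is, if it has this form. -/
noncomputable def simpleSet {ι N : Type*} [AddCommGroup N] [Fintype ι] (X : Finset N)
    (b : Basis ι ℤ N) : Finset ι := {i | ∃ j, b j - b i ∈ X}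

variable {ι N : Type*} [AddCommGroup N] [Fintype ι] {X : Finset N} {b : Basis ι ℤ N}

@[simp] lemma mem_negSupp {x : N} {i : ι} : i ∈ negSupp b x ↔ b.repr x i < 0 := by simp [negSupp]

@[simp] lemma mem_posSupp {x : N} {i : ι} : i ∈ posSupp b x ↔ 0 < b.repr x i := by simp [posSupp]

@[simp] lemma mem_level {x : N} {n : ℤ} : x ∈ level X b n ↔ x ∈ X ∧ height b x = n := by
  simp [level]

lemma mem_exitSet {i : ι} : i ∈ exitSet X b ↔ ∃ w ∈ X, height b w = 0 ∧ b.repr w i < 0 := by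
  simp [exitSet, and_assoc]

@[simp] lemma mem_simpleSet {i : ι} : i ∈ simpleSet X b ↔ ∃ j, b j - b i ∈ X := by
  simp [simpleSet]

lemma card_posSupp_le {x : N} {m : ℤ} (hm : ∀ i, -m ≤ b.repr x i) :
    (#(posSupp b x) : ℤ) ≤ m * #(negSupp b x) + height b x := by
  classical
  rw [posSupp, negSupp, Finset.card_filter, Finset.card_filter, height_apply]
  push_cast
  rw [Finset.mul_sum, ← Finset.sum_add_distrib]
  refine Finset.sum_le_sum fun i _ => ?_
  have := hm i
  split_ifs <;> omega

lemma negSupp_nonempty {x : N} (h : height b x ≤ 0) (h0 : x ≠ 0) : (negSupp b x).Nonempty := by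
  by_contra hne
  rw [Finset.not_nonempty_iff_eq_empty] at hne
  have hx : ∀ i, 0 ≤ b.repr x i := fun i => by
    by_contra! hi
    have := mem_negSupp.2 hi
    simp [hne] at this
  refine h0 (eq_zero_of_height_eq_zero b hx (le_antisymm h ?_))
  rw [height_apply]
  exact Finset.sum_nonneg fun i _ => hx i

lemma IsFanoSystem.one_le_card_negSupp (hX : IsFanoSystem ι X) {x : N} (hx : x ∈ X)
    (h : height b x ≤ 0) :
    1 ≤ #(negSupp b x) :=
  Finset.card_pos.2 (negSupp_nonempty h fun h0 => hX.zero_notMem (h0 ▸ hx))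

namespace IsFacetBasis

variable (hX : IsFanoSystem ι X) (hb : IsFacetBasis X b)
include hX hb

lemma repr_eq_neg_one_of_height_eq_neg_one {x : N} (hx : x ∈ X) (h : height b x = -1) {i : ι}
    (hi : b.repr x i < 0) : b.repr x i = -1 := by
  have := hb.height_le_repr hX hx (by omega) i
  omega

lemma neg_one_le_repr {x : N} (hx : x ∈ X) (h : height b x = 0 ∨ height b x = -1) (i : ι) :
    -1 ≤ b.repr x i := by
  rcases lt_or_ge (b.repr x i) 0 with hi | hi
  · rcases h with h | h
    · exact (hb.repr_eq_neg_one hX hx h hi).ge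
    · exact (hb.repr_eq_neg_one_of_height_eq_neg_one hX hx h hi).ge
  · omega

lemma sum_card_negSupp : ∑ x ∈ level X b 0, #(negSupp b x) = #(exitSet X b) := by
  classical
  rw [exitSet, Finset.card_biUnion]
  intro x hx y hy hxy
  rw [Function.onFun, Finset.disjoint_left]
  intro i hi hj
  rw [mem_coe, mem_level] at *
  exact hxy (hb.eq_of_height_eq_zero hX hx.1 hy.1 hx.2 hy.2 (mem_negSupp.1 hi) (mem_negSupp.1 hj))

lemma card_level_zero_le : #(level X b 0) ≤ #(exitSet X b) := by
  rw [← hb.sum_card_negSupp hX, Finset.card_eq_sum_ones]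
  exact Finset.sum_le_sum fun x hx => hX.one_le_card_negSupp (mem_level.1 hx).1
    (mem_level.1 hx).2.le

lemma card_negSupp_add_le {x : N} (hx : x ∈ level X b 0) :
    #(negSupp b x) + #(level X b 0) ≤ #(exitSet X b) + 1 := by
  classical
  rw [← hb.sum_card_negSupp hX, ← Finset.add_sum_erase _ _ hx,
    ← Finset.card_erase_add_one hx]
  have : #((level X b 0).erase x) ≤ ∑ y ∈ (level X b 0).erase x, #(negSupp b y) := by
    rw [Finset.card_eq_sum_ones]
    exact Finset.sum_le_sum fun y hy => hX.one_le_card_negSupp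
      (mem_level.1 (mem_of_mem_erase hy)).1 (mem_level.1 (mem_of_mem_erase hy)).2.le
  omega

/-- A point of height `0` with a single negative coordinate has the form `b j - b i`. -/
lemma exists_eq_sub {x : N} (hx : x ∈ X) (h : height b x = 0) {i : ι} (hi : b.repr x i < 0)
    (hcard : #(negSupp b x) ≤ 1) : ∃ j, x = b j - b i := by
  refine exists_eq_sub_of_height_eq_zero b (hb.repr_eq_neg_one hX hx h hi) (fun j hj => ?_) h
  by_contra! hj'
  exact hj (Finset.card_le_one.1 hcard j (mem_negSupp.2 hj') i (mem_negSupp.2 hi))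

lemma card_simple_le :
    #{x ∈ level X b 0 | #(negSupp b x) ≤ 1} ≤ #(simpleSet X b) := by
  classical
  refine Finset.card_le_card_of_forall_subsingleton (fun x i => b.repr x i < 0) (fun x hx => ?_)
    (fun i _ x hx y hy => ?_)
  · rw [mem_filter, mem_level] at hx
    obtain ⟨i, hi⟩ := Finset.card_pos.1 (hX.one_le_card_negSupp hx.1.1 hx.1.2.le)
    obtain ⟨j, hj⟩ := hb.exists_eq_sub hX hx.1.1 hx.1.2 (mem_negSupp.1 hi) hx.2
    exact ⟨i, mem_simpleSet.2 ⟨j, hj ▸ hx.1.1⟩, mem_negSupp.1 hi⟩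
  · simp only [mem_filter, mem_level, Set.mem_ofPred_eq] at hx hy
    exact hb.eq_of_height_eq_zero hX hx.1.1.1 hy.1.1.1 hx.1.1.2 hy.1.1.2 hx.2 hy.2

lemma two_mul_card_level_zero_le :
    2 * #(level X b 0) ≤ #(exitSet X b) + #{x ∈ level X b 0 | #(negSupp b x) ≤ 1} := by
  rw [← hb.sum_card_negSupp hX, Finset.card_filter, Finset.card_eq_sum_ones, Finset.mul_sum,
    ← Finset.sum_add_distrib]
  refine Finset.sum_le_sum fun x hx => ?_
  have := hX.one_le_card_negSupp (mem_level.1 hx).1 (mem_level.1 hx).2.le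
  split_ifs <;> omega

/-- The indices at which a non-simple point of height `0` is positive are few: such a point has at
most as many positive coordinates as negative ones, and the negative supports are disjoint. -/
lemma card_posSupp_nonsimple_le [DecidableEq ι] :
    #({x ∈ level X b 0 | ¬ #(negSupp b x) ≤ 1}.biUnion (posSupp b)) +
      #{x ∈ level X b 0 | #(negSupp b x) ≤ 1} ≤ #(exitSet X b) := by
  rw [← hb.sum_card_negSupp hX, ← Finset.sum_filter_add_sum_filter_not (level X b 0)
    (fun x => #(negSupp b x) ≤ 1), add_comm]
  refine add_le_add ?_ (Finset.card_biUnion_le.trans (Finset.sum_le_sum fun x hx => ?_))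
  · rw [Finset.card_eq_sum_ones]
    exact Finset.sum_le_sum fun x hx => hX.one_le_card_negSupp
      (mem_level.1 (mem_filter.1 hx).1).1 (mem_level.1 (mem_filter.1 hx).1).2.le
  · have hx' := mem_level.1 (mem_filter.1 hx).1
    have := card_posSupp_le (m := 1) (hb.neg_one_le_repr hX hx'.1 (Or.inl hx'.2))
    rw [hx'.2] at this
    omega

/-- If there are `d - a` points of height `0`, then at each index at most `a + 1` points of height
`-1` are negative. -/
lemma card_level_neg_one_filter_le (i : ι) :
    #{x ∈ level X b (-1) | b.repr x i < 0} + #(level X b 0) ≤ Fintype.card ι + 1 := by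
  classical
  by_cases hiE : i ∈ exitSet X b
  · obtain ⟨w, hw, hw0, hwi⟩ := mem_exitSet.1 hiE
    obtain ⟨b', hb', h, rfl⟩ := hb.exists_exchange_of_height_eq_zero hX hw hw0 hwi
    -- After the exchange at `i`, all these points have height `0`.
    have hh : ∀ x ∈ ({x ∈ level X b (-1) | b.repr x i < 0} : Finset N),
        x ∈ X ∧ height b x = -1 ∧ b.repr x i = -1 ∧ height b' x = 0 := by
      intro x hx
      rw [mem_filter, mem_level] at hx
      have := hb.repr_eq_neg_one_of_height_eq_neg_one hX hx.1.1 hx.1.2 hx.2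
      exact ⟨hx.1.1, hx.1.2, this, by rw [h.height_eq, hw0, this, hx.1.2]; norm_num⟩
    have h1 : #{x ∈ level X b (-1) | b.repr x i < 0} ≤ #((exitSet X b)ᶜ ∪ posSupp b (b' i)) := by
      refine Finset.card_le_card_of_forall_subsingleton (fun x j => b'.repr x j < 0)
        (fun x hx => ?_) (fun j _ x hx y hy => ?_)
      · obtain ⟨hxX, hx1, hxi, hx0⟩ := hh x hx
        obtain ⟨j, hj⟩ := Finset.card_pos.1 (hX.one_le_card_negSupp (b := b') hxX hx0.le)
        rw [mem_negSupp] at hj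
        have hji : j ≠ i := by
          rintro rfl
          rw [h.repr_same] at hj; omega
        refine ⟨j, ?_, hj⟩
        rw [h.repr_ne x hji, hxi] at hj
        rw [mem_union, mem_compl, mem_posSupp]
        by_contra! hcon
        obtain ⟨v, hv, hv0, hvj⟩ := mem_exitSet.1 hcon.1
        have hxj := hb.neg_one_le_repr hX hxX (Or.inr hx1) j
        have hwj := hb.neg_one_le_repr hX hw (Or.inl hw0) j
        have := hb.eq_of_repr_neg hX hxX hw hv hx1 hw0 hv0 (i := i) (j := j) (by omega) (by omega)
          hwi hvj
        rw [← this] at hvj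
        omega
      · obtain ⟨hxX, -, -, hx0⟩ := hh x hx.1
        obtain ⟨hyX, -, -, hy0⟩ := hh y hy.1
        exact hb'.eq_of_height_eq_zero hX hxX hyX hx0 hy0 hx.2 hy.2
    have h2 := card_posSupp_le (m := 1) (hb.neg_one_le_repr hX hw (Or.inl hw0))
    have h3 := hb.card_negSupp_add_le hX (mem_level.2 ⟨hw, hw0⟩)
    have h4 := Finset.card_union_le ((exitSet X b)ᶜ) (posSupp b (b' i))
    have h5 := Finset.card_add_card_compl (exitSet X b)
    rw [hw0] at h2
    omega
  · have h1 : #{x ∈ level X b (-1) | b.repr x i < 0} ≤ 1 := by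
      refine Finset.card_le_one.2 fun x hx y hy => ?_
      rw [mem_filter, mem_level] at hx hy
      refine hb.eq_of_height_eq_neg_one hX (fun w hw hw0 => ?_) hx.1.1 hy.1.1 hx.1.2 hy.1.2 hx.2
        hy.2
      by_contra! hwi
      exact hiE (mem_exitSet.2 ⟨w, hw, hw0, hwi⟩)
    have h2 := hb.card_level_zero_le hX
    have h3 := Finset.card_le_univ (exitSet X b)
    omega

lemma card_negSupp_inter_le [DecidableEq ι] {x : N} (hx : x ∈ level X b (-1)) :
    #(negSupp b x ∩ simpleSet X b) ≤ 1 := by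
  rw [mem_level] at hx
  refine Finset.card_le_one.2 fun i hi j hj => ?_
  rw [mem_inter, mem_negSupp, mem_simpleSet] at hi hj
  obtain ⟨hi, p, hp⟩ := hi
  obtain ⟨hj, q, hq⟩ := hj
  have hpi := hX.ne_of_sub_mem hp
  have hqj := hX.ne_of_sub_mem hq
  have := hb.eq_of_repr_neg hX hx.1 hp hq hx.2 (height_sub_basis b _ _) (height_sub_basis b _ _)
    hi hj (by rw [repr_sub_basis, if_neg hpi]; simp) (by rw [repr_sub_basis, if_neg hqj]; simp)
  by_contra hij
  have h2 := congrArg (fun x => b.repr x i) this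
  simp only [repr_sub_basis, if_neg hpi, if_neg (Ne.symm hij)] at h2
  split_ifs at h2 <;> omega

/-- A bound for the number of pairs of a point of height `-1` and a non-simple index at which it is
negative, by double counting. -/
lemma sum_card_negSupp_sdiff_le [DecidableEq ι] {a : ℕ}
    (ha : #(level X b 0) + a = Fintype.card ι) :
    ∑ x ∈ level X b (-1), #(negSupp b x \ simpleSet X b) ≤ #(simpleSet X b)ᶜ * (a + 1) := by
  have h := Finset.sum_card_bipartiteAbove_eq_sum_card_bipartiteBelow
    (s := level X b (-1)) (t := (simpleSet X b)ᶜ) (fun x i => b.repr x i < 0)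
  have e : ∀ x, negSupp b x \ simpleSet X b =
      bipartiteAbove (fun x i => b.repr x i < 0) (simpleSet X b)ᶜ x := fun x => by
    ext i; simp [bipartiteAbove, and_comm]
  simp_rw [e, h]
  refine Finset.sum_le_card_nsmul _ _ _ fun i _ => ?_
  have := hb.card_level_neg_one_filter_le hX i
  rw [bipartiteBelow]
  omega

end IsFacetBasis

end Counting

end SmoothFano

/-! ### Indices that belong to hexagons -/

namespace SmoothFano

open Module Finset

section Pairs

variable {ι N : Type*} [AddCommGroup N] [Fintype ι] {X : Finset N} {b : Basis ι ℤ N}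

open scoped Classical in
/-- The points of `X` of height at most `-2`. -/
noncomputable def deepSet {ι N : Type*} [AddCommGroup N] [Fintype ι] (X : Finset N)
    (b : Basis ι ℤ N) : Finset N := {x ∈ X | height b x ≤ -2}

@[simp] lemma mem_deepSet {x : N} : x ∈ deepSet X b ↔ x ∈ X ∧ height b x ≤ -2 := by
  simp [deepSet]

open scoped Classical in
/-- The simple indices `i` for which `-b i` is a vertex, too. -/
noncomputable def oppositeSet {ι N : Type*} [AddCommGroup N] [Fintype ι] (X : Finset N)
    (b : Basis ι ℤ N) : Finset ι := {i ∈ simpleSet X b | -b i ∈ X}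

lemma mem_oppositeSet {i : ι} : i ∈ oppositeSet X b ↔ i ∈ simpleSet X b ∧ -b i ∈ X := by
  simp [oppositeSet]

namespace IsFacetBasis

lemma card_level_one (hb : IsFacetBasis X b) : #(level X b 1) = Fintype.card ι := by
  classical
  have : level X b 1 = univ.image b := by
    ext x
    rw [mem_level, mem_image]
    constructor
    · rintro ⟨hx, h⟩
      obtain ⟨i, hi⟩ := hb.eq_of_height x hx h
      exact ⟨i, mem_univ i, hi⟩
    · rintro ⟨i, -, rfl⟩
      exact ⟨hb.mem i, height_basis b i⟩
  rw [this, Finset.card_image_of_injective _ b.injective, Finset.card_univ]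

lemma card_eq (hb : IsFacetBasis X b) :
    #X = Fintype.card ι + #(level X b 0) + #(level X b (-1)) + #(deepSet X b) := by
  rw [← hb.card_level_one]
  simp only [level, deepSet, Finset.card_filter]
  rw [Finset.card_eq_sum_ones, ← Finset.sum_add_distrib, ← Finset.sum_add_distrib,
    ← Finset.sum_add_distrib]
  refine Finset.sum_congr rfl fun x hx => ?_
  have := hb.height_le x hx
  split_ifs <;> omega

lemma sum_height (hb : IsFacetBasis X b) :
    ∑ x ∈ X, height b x =
      Fintype.card ι - #(level X b (-1)) + ∑ x ∈ deepSet X b, height b x := by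
  rw [← hb.card_level_one]
  simp only [level, deepSet, Finset.card_filter, Finset.sum_filter]
  push_cast
  rw [← Finset.sum_sub_distrib, ← Finset.sum_add_distrib]
  refine Finset.sum_congr rfl fun x hx => ?_
  have := hb.height_le x hx
  split_ifs <;> omega

lemma two_mul_card_le_simpleSet (hX : IsFanoSystem ι X) (hb : IsFacetBasis X b) :
    2 * #(level X b 0) ≤ Fintype.card ι + #(simpleSet X b) := by
  have h1 := hb.two_mul_card_level_zero_le hX
  have h2 := hb.card_simple_le hX
  have h3 := Finset.card_le_univ (exitSet X b)
  omega

/-- A vertex of height `-1` without negative non-simple coordinates is the negative of a vertex of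
the facet. -/
lemma card_level_neg_one_le [DecidableEq ι] (hX : IsFanoSystem ι X) (hb : IsFacetBasis X b) :
    #(level X b (-1)) ≤ #(oppositeSet X b) +
      ∑ x ∈ level X b (-1), #(negSupp b x \ simpleSet X b) := by
  classical
  have h1 : #{x ∈ level X b (-1) | #(negSupp b x \ simpleSet X b) = 0} ≤ #(oppositeSet X b) := by
    refine (Finset.card_le_card ?_).trans (Finset.card_image_le (f := fun i => -b i))
    intro x hx
    obtain ⟨hx, h0⟩ := mem_filter.1 hx
    have hx' := mem_level.1 hx
    obtain ⟨i, hi⟩ := Finset.card_pos.1 (hX.one_le_card_negSupp hx'.1 (b := b) (by omega))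
    have hsub := Finset.sdiff_eq_empty_iff_subset.1 (Finset.card_eq_zero.1 h0)
    have hle := hb.card_negSupp_inter_le hX hx
    rw [Finset.inter_eq_left.2 hsub] at hle
    have hxi := mem_negSupp.1 hi
    have hxe := eq_neg_of_height_eq_neg_one b
      (hb.repr_eq_neg_one_of_height_eq_neg_one hX hx'.1 hx'.2 hxi)
      (fun j hj => by
        by_contra! hj'
        exact hj (Finset.card_le_one.1 hle j (mem_negSupp.2 hj') i hi)) hx'.2
    exact mem_image.2 ⟨i, mem_oppositeSet.2 ⟨hsub hi, hxe ▸ hx'.1⟩, hxe.symm⟩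
  have h2 : #(level X b (-1)) ≤ #{x ∈ level X b (-1) | #(negSupp b x \ simpleSet X b) = 0} +
      ∑ x ∈ level X b (-1), #(negSupp b x \ simpleSet X b) := by
    rw [Finset.card_filter, ← Finset.sum_add_distrib, Finset.card_eq_sum_ones]
    refine Finset.sum_le_sum fun x _ => ?_
    split_ifs <;> omega
  omega

lemma card_biUnion_posSupp_le [DecidableEq ι] (hX : IsFanoSystem ι X) (hb : IsFacetBasis X b) :
    #((level X b (-1)).biUnion (posSupp b)) ≤
      ∑ x ∈ level X b (-1), #(negSupp b x \ simpleSet X b) := by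
  refine Finset.card_biUnion_le.trans (Finset.sum_le_sum fun x hx => ?_)
  have hx' := mem_level.1 hx
  have h1 := card_posSupp_le (m := 1) (hb.neg_one_le_repr hX hx'.1 (Or.inr hx'.2))
  have h2 := hb.card_negSupp_inter_le hX hx
  have h3 := Finset.card_sdiff_add_card_inter (negSupp b x) (simpleSet X b)
  rw [hx'.2] at h1
  omega

/-- The size of the support of a vertex of height at most `-2`. -/
lemma card_supp_le [DecidableEq ι] (hX : IsFanoSystem ι X) (hb : IsFacetBasis X b) {r t : ℕ}
    (hr : #(simpleSet X b)ᶜ ≤ r) (ht : 1 ≤ t) {x : N} (hx : x ∈ X)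
    (hxt : height b x = -(t + 1 : ℕ)) :
    #(negSupp b x ∪ posSupp b x) ≤ (3 * t + 16 + 3 * r) * t := by
  have h1 : ∀ i ∈ negSupp b x ∩ simpleSet X b, ∃ j, b j - b i ∈ X := fun i hi => by
    simpa using (mem_inter.1 hi).2
  have h2 : #(negSupp b x ∩ simpleSet X b) ≤ 3 * (t + 1) + 1 := by
    choose! φ hφ using h1
    have := card_le_of_repr_neg hX φ _ b hb hφ x hx (by omega) fun i hi =>
      mem_negSupp.1 (mem_inter.1 hi).1
    omega
  have h3 := Finset.card_sdiff_add_card_inter (negSupp b x) (simpleSet X b)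
  have h4 : #(negSupp b x \ simpleSet X b) ≤ #(simpleSet X b)ᶜ :=
    Finset.card_le_card fun i hi => by
      rw [mem_sdiff] at hi; exact mem_compl.2 hi.2
  have h5 : (#(negSupp b x) : ℤ) ≤ 3 * (t + 1) + 1 + r := by omega
  have h6 := card_posSupp_le (b := b) (x := x) (m := t + 1) (fun i => by
    have := hb.height_le_repr hX hx (by omega) i
    omega)
  have h7 := Finset.card_union_le (negSupp b x) (posSupp b x)
  have h8 : (#(negSupp b x ∪ posSupp b x) : ℤ) ≤ #(negSupp b x) + #(posSupp b x) := by
    exact_mod_cast h7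
  have ht' : (1 : ℤ) ≤ t := by exact_mod_cast ht
  have hr' : (0 : ℤ) ≤ r := by positivity
  zify
  rw [hxt] at h6
  push_cast at h6
  nlinarith

end IsFacetBasis

open scoped Classical in
/-- The indices that are not known to belong to a hexagon: those that are not opposite, and those at
which some vertex has a coordinate that it would not have in a direct sum of hexagons. The map `φ`
is meant to send a simple index `i` to the index `j` for which `b j - b i` is a vertex. -/
noncomputable def exceptionalSet {ι N : Type*} [AddCommGroup N] [Fintype ι] (X : Finset N)
    (b : Basis ι ℤ N) (φ : ι → ι) : Finset ι :=
  (oppositeSet X b)ᶜ ∪ (level X b (-1)).biUnion (posSupp b) ∪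
    (deepSet X b).biUnion (fun x => negSupp b x ∪ posSupp b x) ∪
    {x ∈ level X b 0 | ¬ #(negSupp b x) ≤ 1}.biUnion (posSupp b) ∪
    (simpleSet X b \ oppositeSet X b).image φ

/-- The final estimate: `d - a` is the number of vertices of height `0`, `c` is the number of levels
below `-1` summed over the vertices, `g` is the number of indices that are not opposite, and `u` is
the number of exceptional indices. -/
lemma two_mul_le_of_estimates {a c k M g u : ℕ} (h1 : a + c ≤ k) (h2 : g + a ≤ k + c + M)
    (h3 : M ≤ 2 * a * (a + 1))
    (h4 : u ≤ g + M + (3 * c + 16 + 3 * (2 * a)) * c + 2 * a + g) :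
    2 * u ≤ 15 * k ^ 2 + 37 * k := by
  have hk : k ≤ k ^ 2 := Nat.le_self_pow (by norm_num) k
  have hac : (a + c) ^ 2 ≤ k ^ 2 := Nat.pow_le_pow_left h1 2
  have h5 : 2 * u ≤ 4 * k + 36 * c + 12 * a + 12 * (a + c) ^ 2 := by
    have : 2 * g + 2 * a ≤ 2 * k + 2 * c + 2 * M := by omega
    nlinarith [Nat.zero_le (a * c), Nat.zero_le (c * c)]
  omega

/-- All but `O(k²)` of the indices are regular, where `k` is the number of vertices by which `X`
falls short of the maximal number `3d`. -/
lemma IsFacetBasis.two_mul_card_exceptionalSet_le (hX : IsFanoSystem ι X) (hb : IsFacetBasis X b)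
    {k : ℕ} (hcard : #X + k = 3 * Fintype.card ι)
    (hsum : ∀ i, 0 ≤ b.repr (∑ x ∈ X, x) i) (φ : ι → ι) :
    2 * #(exceptionalSet X b φ) ≤ 15 * k ^ 2 + 37 * k := by
  classical
  obtain ⟨a, ha⟩ : ∃ a, #(level X b 0) + a = Fintype.card ι :=
    ⟨_, Nat.add_sub_of_le ((hb.card_level_zero_le hX).trans (Finset.card_le_univ _))⟩
  -- The number of levels below `-1`, summed over the vertices.
  obtain ⟨c, hc⟩ : ∃ c, c = ∑ x ∈ deepSet X b, (-height b x - 1).toNat := ⟨_, rfl⟩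
  have hdeep : #(deepSet X b) ≤ c := by
    rw [hc, Finset.card_eq_sum_ones]
    refine Finset.sum_le_sum fun x hx => ?_
    have := (mem_deepSet.1 hx).2
    omega
  have hcZ : (c : ℤ) = -∑ x ∈ deepSet X b, height b x - #(deepSet X b) := by
    rw [hc, Finset.card_eq_sum_ones]
    push_cast
    rw [← Finset.sum_neg_distrib, ← Finset.sum_sub_distrib]
    refine Finset.sum_congr rfl fun x hx => ?_
    have := (mem_deepSet.1 hx).2
    omega
  have hsum' : 0 ≤ ∑ x ∈ X, height b x := by
    rw [← map_sum, height_apply]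
    exact Finset.sum_nonneg fun i _ => hsum i
  rw [hb.sum_height] at hsum'
  have hcardX := hb.card_eq
  have hDc : #(simpleSet X b)ᶜ ≤ 2 * a := by
    have h1 := hb.two_mul_card_le_simpleSet hX
    have h2 := Finset.card_add_card_compl (simpleSet X b)
    omega
  have hM := (hb.sum_card_negSupp_sdiff_le hX ha).trans (Nat.mul_le_mul_right _ hDc)
  have h1 := hb.card_level_neg_one_le hX
  have h2 := hb.card_biUnion_posSupp_le hX
  have h3 : #((deepSet X b).biUnion (fun x => negSupp b x ∪ posSupp b x)) ≤
      (3 * c + 16 + 3 * (2 * a)) * c := by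
    refine Finset.card_biUnion_le.trans ?_
    conv_rhs => rw [hc, Finset.mul_sum]
    refine Finset.sum_le_sum fun x hx => ?_
    have hx' := mem_deepSet.1 hx
    have hle : (-height b x - 1).toNat ≤ c := hc ▸
      Finset.single_le_sum (f := fun x => (-height b x - 1).toNat) (fun _ _ => Nat.zero_le _) hx
    refine (hb.card_supp_le hX hDc (t := (-height b x - 1).toNat) (by omega) hx'.1
      (by omega)).trans (Nat.mul_le_mul_right _ ?_)
    rw [← hc]
    omega
  have h4 : #({x ∈ level X b 0 | ¬ #(negSupp b x) ≤ 1}.biUnion (posSupp b)) ≤ 2 * a := by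
    have e1 := hb.card_posSupp_nonsimple_le hX
    have e2 := hb.two_mul_card_level_zero_le hX
    have e3 := Finset.card_le_univ (exitSet X b)
    omega
  have h5 : #((simpleSet X b \ oppositeSet X b).image φ) ≤ #(oppositeSet X b)ᶜ :=
    Finset.card_image_le.trans (Finset.card_le_card fun i hi => mem_compl.2 (mem_sdiff.1 hi).2)
  have h7 := Finset.card_add_card_compl (oppositeSet X b)
  refine two_mul_le_of_estimates (a := a) (c := c) (g := #(oppositeSet X b)ᶜ) (by omega)
    (by omega) hM ?_
  rw [exceptionalSet]
  refine (Finset.card_union_le _ _).trans (add_le_add ?_ h5)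
  refine (Finset.card_union_le _ _).trans (add_le_add ?_ h4)
  refine (Finset.card_union_le _ _).trans (add_le_add ?_ h3)
  exact (Finset.card_union_le _ _).trans (add_le_add le_rfl h2)

/-- If a lattice basis `b` is the vertex set of a facet whose cone contains the sum of all
vertices, and if there are `3d - k` vertices, then all but `O(k²)` of the members of `b` come in
pairs `b i, b (φ i)` that generate a hexagon `±b i, ±b (φ i), ±(b i - b (φ i))`, and no other vertex
has a nonzero `i`-th coordinate. -/
theorem exists_hexagon_pairs (hX : IsFanoSystem ι X) (hb : IsFacetBasis X b) {k : ℕ}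
    (hcard : #X + k = 3 * Fintype.card ι) (hsum : ∀ i, 0 ≤ b.repr (∑ x ∈ X, x) i) :
    ∃ (T : Finset ι) (φ : ι → ι), Fintype.card ι ≤ #T + (15 * k ^ 2 + 37 * k) ∧
      ∀ i ∈ T, φ i ∈ T ∧ φ i ≠ i ∧ φ (φ i) = i ∧ -b i ∈ X ∧ b (φ i) - b i ∈ X ∧
        ∀ x ∈ X, b.repr x i ≠ 0 → x = b i ∨ x = -b i ∨ x = b (φ i) - b i ∨ x = b i - b (φ i) := by
  classical
  obtain ⟨φ, hφ⟩ : ∃ φ : ι → ι, ∀ i ∈ simpleSet X b, b (φ i) - b i ∈ X := by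
    have : ∀ i ∈ simpleSet X b, ∃ j, b j - b i ∈ X := fun i hi => mem_simpleSet.1 hi
    choose! φ hφ using this
    exact ⟨φ, hφ⟩
  set D := simpleSet X b with hD
  set G := oppositeSet X b with hG
  have hGD : ∀ i ∈ G, i ∈ D := fun i hi => (mem_oppositeSet.1 hi).1
  have hGneg : ∀ i ∈ G, -b i ∈ X := fun i hi => (mem_oppositeSet.1 hi).2
  -- `φ` is an involution as far as possible.
  have hinv : ∀ i ∈ G, φ i ∈ D → φ (φ i) = i := fun i hi hi' =>
    hb.eq_of_sub_mem_of_neg_mem hX (hφ i (hGD i hi)) (hGneg i hi) (hφ _ hi')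
  have hinj : ∀ i ∈ G, ∀ j ∈ G, φ i = φ j → i = j := fun i hi j hj hij =>
    hb.eq_of_sub_mem_of_sub_mem hX (hφ i (hGD i hi)) (hGneg i hi)
      (hij ▸ hφ j (hGD j hj)) (hGneg j hj)
  have hout : ∀ l, l ∉ exceptionalSet X b φ → l ∈ G ∧ l ∉ (level X b (-1)).biUnion (posSupp b) ∧
      l ∉ (deepSet X b).biUnion (fun x => negSupp b x ∪ posSupp b x) ∧
      l ∉ {x ∈ level X b 0 | ¬ #(negSupp b x) ≤ 1}.biUnion (posSupp b) ∧
      l ∉ (D \ G).image φ := fun l hl => by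
    rw [exceptionalSet] at hl
    simp only [mem_union, mem_compl, not_or, not_not] at hl
    exact ⟨hl.1.1.1.1, hl.1.1.1.2, hl.1.1.2, hl.1.2, hl.2⟩
  set U := exceptionalSet X b φ with hU
  refine ⟨Finset.univ.filter fun i => i ∉ U ∧ φ i ∉ U, φ, ?_, fun i hi => ?_⟩
  · have h := hb.two_mul_card_exceptionalSet_le hX hcard hsum φ
    have e1 : #(Finset.univ.filter fun i => i ∉ U ∧ φ i ∈ U) ≤ #U :=
      Finset.card_le_card_of_injOn φ (fun i hi => by simpa using (mem_filter.1 hi).2.2)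
        fun i hi j hj hij => hinj i (hout i (mem_filter.1 hi).2.1).1 j
          (hout j (mem_filter.1 hj).2.1).1 hij
    have e2 : Uᶜ ⊆ (Finset.univ.filter fun i => i ∉ U ∧ φ i ∉ U) ∪
        (Finset.univ.filter fun i => i ∉ U ∧ φ i ∈ U) := fun i hi => by
      simp only [mem_compl, mem_union, mem_filter, mem_univ, true_and] at hi ⊢
      tauto
    have e3 := (Finset.card_le_card e2).trans (Finset.card_union_le _ _)
    have e4 := Finset.card_add_card_compl U
    rw [← hU] at h
    omega
  · -- The vertices with a nonzero `i`-th coordinate.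
    obtain ⟨hiU, hiU'⟩ := (mem_filter.1 hi).2
    obtain ⟨hiG, hi1, hi2, hi3, hi4⟩ := hout i hiU
    obtain ⟨hjG, hj1, hj2, hj3, hj4⟩ := hout _ hiU'
    have hφφ := hinv i hiG (hGD _ hjG)
    have hsub := hφ i (hGD i hiG)
    have hne := hX.ne_of_sub_mem hsub
    refine ⟨by simp [hφφ, hiU, hiU'], hne, hφφ, hGneg i hiG, hsub, fun x hx hxi => ?_⟩
    have hle := hb.height_le x hx
    obtain h | h | h | h : height b x = 1 ∨ height b x = 0 ∨ height b x = -1 ∨ height b x ≤ -2 := by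
      omega
    · obtain ⟨j, rfl⟩ := hb.eq_of_height x hx h
      left
      by_contra hji
      exact hxi (by rw [b.repr_self, Finsupp.single_apply, if_neg (fun h => hji (congrArg b h))])
    · rcases lt_or_gt_of_ne hxi with hneg | hpos
      · refine Or.inr (Or.inr (Or.inl ?_))
        exact hb.eq_of_height_eq_zero hX hx hsub h (height_sub_basis b _ _) hneg
          (by rw [repr_sub_basis, if_neg hne]; simp)
      · have hs : #(negSupp b x) ≤ 1 := by
          by_contra hcon
          exact hi3 (mem_biUnion.2 ⟨x, by simp only [mem_filter, mem_level]; exact ⟨⟨hx, h⟩, hcon⟩,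
            mem_posSupp.2 hpos⟩)
        obtain ⟨q, hq⟩ := Finset.card_pos.1 (hX.one_le_card_negSupp (b := b) hx h.le)
        obtain ⟨p, rfl⟩ := hb.exists_eq_sub hX hx h (mem_negSupp.1 hq) hs
        have hpi : p = i := by
          by_contra hpi
          rw [repr_sub_basis, if_neg hpi] at hpos
          split_ifs at hpos <;> omega
        subst hpi
        have hqD : q ∈ D := mem_simpleSet.2 ⟨p, hx⟩
        have hqp : φ q = p := by
          have := hb.eq_of_height_eq_zero hX (hφ q hqD) hx (height_sub_basis b _ _)
            (height_sub_basis b _ _) (i := q)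
            (by rw [repr_sub_basis, if_neg (hX.ne_of_sub_mem (hφ q hqD))]; simp)
            (mem_negSupp.1 hq)
          exact b.injective (sub_left_injective this)
        have hqG : q ∈ G := by
          by_contra hqG
          exact hi4 (mem_image.2 ⟨q, mem_sdiff.2 ⟨hqD, hqG⟩, hqp⟩)
        have := hinv q hqG (hqp ▸ hGD p hiG)
        rw [hqp] at this
        rw [this]
        simp
    · rcases lt_or_gt_of_ne hxi with hneg | hpos
      · by_cases hxe : x = -b i
        · exact Or.inr (Or.inl hxe)
        · exact absurd (mem_biUnion.2 ⟨x, mem_level.2 ⟨hx, h⟩, mem_posSupp.2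
            (hb.repr_pos_of_repr_neg hX hsub (hGneg i hiG) hx h hneg hxe)⟩) hj1
      · exact absurd (mem_biUnion.2 ⟨x, mem_level.2 ⟨hx, h⟩, mem_posSupp.2 hpos⟩) hi1
    · refine absurd (mem_biUnion.2 ⟨x, mem_deepSet.2 ⟨hx, h⟩, ?_⟩) hi2
      rw [mem_union, mem_negSupp, mem_posSupp]
      omega

end Pairs

end SmoothFano

/-! ### Facets of smooth Fano polytopes -/

namespace SmoothFano

open Module Set Topology

section Geometry

variable {V : Type*} [NormedAddCommGroup V] [NormedSpace ℝ V]

lemma finrank_span_eq_finrank_vectorSpan_add_one [FiniteDimensional ℝ V] {F : Set V}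
    (hF : F.Nonempty) (u : V →ₗ[ℝ] ℝ)
    (hu : ∀ x ∈ F, u x = 1) :
    finrank ℝ (Submodule.span ℝ F) = finrank ℝ (vectorSpan ℝ F) + 1 := by
  obtain ⟨x₀, hx₀⟩ := hF
  have hker : vectorSpan ℝ F ≤ LinearMap.ker u := by
    rw [vectorSpan_def, Submodule.span_le]
    rintro _ ⟨x, hx, y, hy, rfl⟩
    simp [hu x hx, hu y hy]
  have hsup : Submodule.span ℝ F = vectorSpan ℝ F ⊔ Submodule.span ℝ {x₀} := by
    apply le_antisymm
    · rw [Submodule.span_le]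
      intro x hx
      have : x = (x -ᵥ x₀) + x₀ := by simp
      rw [SetLike.mem_coe, this]
      exact Submodule.add_mem_sup (vsub_mem_vectorSpan ℝ hx hx₀)
        (Submodule.mem_span_singleton_self _)
    · refine sup_le ?_ (Submodule.span_mono (singleton_subset_iff.2 hx₀))
      rw [vectorSpan_def, Submodule.span_le]
      rintro _ ⟨x, hx, y, hy, rfl⟩
      exact Submodule.sub_mem _ (Submodule.subset_span hx) (Submodule.subset_span hy)
  have hinf : vectorSpan ℝ F ⊓ Submodule.span ℝ {x₀} = ⊥ := by
    rw [Submodule.eq_bot_iff]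
    rintro x ⟨hx, hx'⟩
    obtain ⟨c, rfl⟩ := Submodule.mem_span_singleton.1 hx'
    have := hker hx
    simp only [LinearMap.mem_ker, map_smul, hu x₀ hx₀, smul_eq_mul, mul_one] at this
    simp [this]
  have hne : x₀ ≠ 0 := fun h => by
    have := hu x₀ hx₀
    simp [h] at this
  have := Submodule.finrank_sup_add_finrank_inf_eq (vectorSpan ℝ F) (Submodule.span ℝ {x₀})
  rw [hinf, finrank_bot, add_zero, finrank_span_singleton hne] at this
  rw [hsup, this]

lemma vectorSpan_eq_top {P : Set V} (h : (0 : V) ∈ interior P) : vectorSpan ℝ P = ⊤ := by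
  rw [← direction_affineSpan, affineSpan_eq_top_of_nonempty_interior ⟨0, ?_⟩,
    AffineSubspace.direction_top]
  exact interior_mono (subset_convexHull ℝ P) h

/-- A linear functional that is nonpositive on a neighbourhood of the origin vanishes. -/
lemma eq_zero_of_nonpos {P : Set V} (h : (0 : V) ∈ interior P) (u : V →ₗ[ℝ] ℝ)
    (hu : ∀ x ∈ P, u x ≤ 0) : u = 0 := by
  obtain ⟨r, hr, hball⟩ := Metric.mem_nhds_iff.1 (mem_interior_iff_mem_nhds.1 h)
  have key : ∀ x, u x ≤ 0 := fun x => by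
    have hpos : 0 < r / (‖x‖ + 1) := by positivity
    have hmem : (r / (‖x‖ + 1)) • x ∈ P := hball (by
      rw [mem_ball_zero_iff, norm_smul, Real.norm_of_nonneg hpos.le, div_mul_eq_mul_div,
        div_lt_iff₀ (by positivity)]
      nlinarith)
    have := hu _ hmem
    rw [map_smul, smul_eq_mul] at this
    exact nonpos_of_mul_nonpos_right this hpos
  refine LinearMap.ext fun x => le_antisymm (key x) ?_
  have := key (-x)
  rw [map_neg] at this
  rw [LinearMap.zero_apply]
  linarith

lemma exists_pos_forall_mul_abs_le {α : Type*} (S : Finset α) (f g : α → ℝ) :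
    ∃ ε : ℝ, 0 < ε ∧ ∀ x ∈ S, 0 < f x → ε * |g x| ≤ f x := by
  have h : ∀ᶠ ε in 𝓝[>] (0 : ℝ), ∀ x ∈ S, 0 < f x → ε * |g x| ≤ f x := by
    rw [Finset.eventually_all]
    intro x _
    by_cases hx : 0 < f x
    · have : Filter.Tendsto (fun ε : ℝ => ε * |g x|) (𝓝[>] 0) (𝓝 (0 * |g x|)) :=
        tendsto_nhdsWithin_of_tendsto_nhds ((continuous_id.mul continuous_const).tendsto 0)
      rw [zero_mul] at this
      filter_upwards [this.eventually_lt_const hx] with ε hε _ using hε.le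
    · exact Filter.Eventually.of_forall fun _ h => absurd h hx
  obtain ⟨ε, hε, hpos⟩ := (h.and self_mem_nhdsWithin).exists
  exact ⟨ε, hpos, hε⟩

section Polytopes

variable {N : Submodule ℤ V} {P : Set V}

lemma _root_.IsSmoothFano.isCompact [FiniteDimensional ℝ V] (hP : IsSmoothFano N P) :
    IsCompact P := by
  obtain ⟨S, rfl⟩ := hP.polytope
  exact S.finite_toSet.isCompact_convexHull (𝕜 := ℝ)

lemma _root_.IsSmoothFano.convex (hP : IsSmoothFano N P) : Convex ℝ P := by
  obtain ⟨S, rfl⟩ := hP.polytope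
  exact convex_convexHull ℝ _

lemma _root_.IsSmoothFano.finite_extremePoints (hP : IsSmoothFano N P) :
    (P.extremePoints ℝ).Finite := by
  obtain ⟨S, rfl⟩ := hP.polytope
  exact S.finite_toSet.subset extremePoints_convexHull_subset

lemma _root_.IsSmoothFano.exists_finset (hP : IsSmoothFano N P) :
    ∃ X : Finset N, ((↑) '' (X : Set N) : Set V) = P.extremePoints ℝ := by
  have hfin : ((↑) ⁻¹' P.extremePoints ℝ : Set N).Finite :=
    hP.finite_extremePoints.preimage Subtype.val_injective.injOn
  refine ⟨hfin.toFinset, ?_⟩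
  rw [hfin.coe_toFinset, image_preimage_eq_inter_range, inter_eq_left]
  exact fun x hx => ⟨⟨x, hP.lattice x hx⟩, rfl⟩

variable [FiniteDimensional ℝ V]

lemma _root_.IsSmoothFano.convexHull_extremePoints (hP : IsSmoothFano N P) :
    convexHull ℝ (P.extremePoints ℝ) = P := by
  rw [← (hP.finite_extremePoints.isClosed_convexHull (𝕜 := ℝ)).closure_eq]
  exact closure_convexHull_extremePoints hP.isCompact hP.convex

lemma le_of_forall_extremePoints (hP : IsSmoothFano N P) (u : V →ₗ[ℝ] ℝ) {c : ℝ}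
    (hu : ∀ x ∈ P.extremePoints ℝ, u x ≤ c) : ∀ x ∈ P, u x ≤ c := by
  intro x hx
  rw [← hP.convexHull_extremePoints] at hx
  exact convexHull_min (t := {x | u x ≤ c}) hu (convex_halfSpace_le u.isLinear c) hx

/-- A linear functional `u` that is at most `1` on `P`, and equal to `1` on a spanning set of
vertices, defines a facet. -/
lemma exists_basis_of_span_eq_top (hP : IsSmoothFano N P) (hV : 0 < finrank ℝ V)
    (u : V →ₗ[ℝ] ℝ) (hu : ∀ x ∈ P.extremePoints ℝ, u x ≤ 1)
    (hspan : Submodule.span ℝ {x ∈ P.extremePoints ℝ | u x = 1} = ⊤) :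
    ∃ b : Basis (Fin (finrank ℝ V)) ℤ N,
      Set.range (fun i => (b i : V)) = {x ∈ P.extremePoints ℝ | u x = 1} := by
  have hle := le_of_forall_extremePoints hP u hu
  set F : Set V := {x ∈ P | u x = 1} with hF
  have hsub : {x ∈ P.extremePoints ℝ | u x = 1} ⊆ F := fun x hx => ⟨hx.1.1, hx.2⟩
  have hFne : F.Nonempty := by
    by_contra hne
    rw [not_nonempty_iff_eq_empty] at hne
    have hemp := hsub
    rw [hne, subset_empty_iff] at hemp
    rw [hemp, Submodule.span_empty] at hspan
    rw [← finrank_top ℝ V, ← hspan, finrank_bot] at hV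
    exact lt_irrefl _ hV
  have hexp : IsExposed ℝ P F := by
    obtain ⟨x₀, hx₀⟩ := hFne
    refine fun _ => ⟨u.toContinuousLinearMap, ?_⟩
    ext x
    simp only [hF, mem_ofPred_eq, LinearMap.coe_toContinuousLinearMap']
    exact ⟨fun h => ⟨h.1, fun y hy => h.2 ▸ hle y hy⟩,
      fun h => ⟨h.1, le_antisymm (hle x h.1) (hx₀.2 ▸ h.2 x₀ hx₀.1)⟩⟩
  obtain ⟨b, hb⟩ := hP.facet_basis F ⟨hexp, hFne, by
    rw [← finrank_span_eq_finrank_vectorSpan_add_one hFne u fun x hx => hx.2,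
      vectorSpan_eq_top hP.zero_mem_interior,
      top_le_iff.1 (hspan.ge.trans (Submodule.span_mono hsub))]⟩
  refine ⟨b, hb.trans ?_⟩
  rw [hexp.isExtreme.extremePoints_eq]
  ext x
  exact ⟨fun h => ⟨h.2, h.1.2⟩, fun h => ⟨⟨h.1.1, h.2⟩, h.1⟩⟩

end Polytopes

end Geometry

end SmoothFano

/-! ### Facet functionals and linear programming -/

namespace SmoothFano

open Module Set Topology

section FacetFunctionals

variable {V : Type*} [NormedAddCommGroup V] [NormedSpace ℝ V]
  {N : Submodule ℤ V} {P : Set V}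

lemma height_eq_of_basis {ι : Type*} [Fintype ι] {b : Basis ι ℤ N} {u : V →ₗ[ℝ] ℝ}
    (hu : ∀ i, u (b i) = 1) (x : N) :
    (height b x : ℝ) = u x := by
  have : (Int.castAddHom ℝ).toIntLinearMap ∘ₗ height b = u.restrictScalars ℤ ∘ₗ N.subtype :=
    b.ext fun i => by simp [hu]
  simpa using congrArg (fun f => f x) this

lemma zero_notMem_of_finrank_pos {X : Finset N} (hP : IsSmoothFano N P)
    (hX : ((↑) '' (X : Set N) : Set V) = P.extremePoints ℝ) (hV : 0 < finrank ℝ V) :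
    (0 : N) ∉ X := by
  intro h0
  have hmem : (0 : V) ∈ P.extremePoints ℝ := hX ▸ ⟨0, h0, rfl⟩
  obtain ⟨v, hv⟩ : ∃ v : V, v ≠ 0 := by
    have := Module.nontrivial_of_finrank_pos hV
    exact exists_ne 0
  obtain ⟨r, hr, hball⟩ :=
    Metric.mem_nhds_iff.1 (mem_interior_iff_mem_nhds.1 hP.zero_mem_interior)
  have hvn : 0 < ‖v‖ := norm_pos_iff.2 hv
  have hs : ‖(r / (2 * ‖v‖)) • v‖ < r := by
    rw [norm_smul, Real.norm_of_nonneg (by positivity)]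
    field_simp
    linarith
  have := (mem_extremePoints_iff_left.1 hmem).2 ((r / (2 * ‖v‖)) • v)
    (hball (by rwa [mem_ball_zero_iff])) (-((r / (2 * ‖v‖)) • v))
    (hball (by rwa [mem_ball_zero_iff, norm_neg]))
    ⟨1 / 2, 1 / 2, by norm_num, by norm_num, by norm_num, by module⟩
  rw [smul_eq_zero] at this
  rcases this with h | h
  · have : 0 < r / (2 * ‖v‖) := by positivity
    exact this.ne' h
  · exact hv h

variable [FiniteDimensional ℝ V]

lemma isCompact_polar (hP : IsSmoothFano N P) :
    IsCompact {u : V →L[ℝ] ℝ | ∀ x ∈ P.extremePoints ℝ, u x ≤ 1} := by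
  refine Metric.isCompact_of_isClosed_isBounded ?_ ?_
  · simp only [ofPred_forall]
    exact isClosed_iInter fun x => isClosed_iInter fun _ =>
      isClosed_le (ContinuousLinearMap.apply ℝ ℝ x).continuous continuous_const
  · obtain ⟨r, hr, hball⟩ :=
      Metric.mem_nhds_iff.1 (mem_interior_iff_mem_nhds.1 hP.zero_mem_interior)
    refine isBounded_iff_forall_norm_le.2 ⟨2 / r, fun u hu => ?_⟩
    refine u.opNorm_le_bound (by positivity) fun x => ?_
    have hle := le_of_forall_extremePoints hP u.toLinearMap hu
    rcases eq_or_ne x 0 with rfl | hx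
    · simp
    have hxn : 0 < ‖x‖ := norm_pos_iff.2 hx
    have key : ∀ s : ℝ, |s| = 1 → s * u x ≤ 2 / r * ‖x‖ := fun s hs => by
      have hmem : (s * (r / (2 * ‖x‖))) • x ∈ P := hball (by
        rw [mem_ball_zero_iff, norm_smul, norm_mul, Real.norm_eq_abs, hs, Real.norm_eq_abs,
          abs_of_pos (by positivity)]
        field_simp
        linarith)
      have h := hle _ hmem
      simp only [ContinuousLinearMap.coe_coe, map_smul, smul_eq_mul] at h
      have e : s * u x = (s * (r / (2 * ‖x‖)) * u x) * (2 / r * ‖x‖) := by field_simp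
      rw [e]
      exact mul_le_of_le_one_left (by positivity) h
    rw [Real.norm_eq_abs, abs_le]
    constructor
    · linarith [key (-1) (by simp)]
    · linarith [key 1 (by simp)]

/-- Linear programming: over the polar of `P`, evaluation at `p` attains its maximum at a vertex of
the polar, that is, at the linear functional of a facet. -/
lemma exists_maximal_functional (hP : IsSmoothFano N P) (p : V) :
    ∃ u : V →ₗ[ℝ] ℝ, (∀ x ∈ P.extremePoints ℝ, u x ≤ 1) ∧
      Submodule.span ℝ {x ∈ P.extremePoints ℝ | u x = 1} = ⊤ ∧
      ∀ v : V →ₗ[ℝ] ℝ, (∀ x ∈ P.extremePoints ℝ, v x ≤ 1) → v p ≤ u p := by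
  set K := {u : V →L[ℝ] ℝ | ∀ x ∈ P.extremePoints ℝ, u x ≤ 1} with hK
  have hKc : IsCompact K := isCompact_polar hP
  have hcont : Continuous fun u : V →L[ℝ] ℝ => u p := (ContinuousLinearMap.apply ℝ ℝ p).continuous
  obtain ⟨u₀, hu₀, hmax⟩ := hKc.exists_isMaxOn ⟨0, fun x _ => by simp⟩ hcont.continuousOn
  have hMc : IsCompact (K ∩ {u | u p = u₀ p}) :=
    hKc.inter_right (isClosed_eq hcont continuous_const)
  obtain ⟨u, hu⟩ := hMc.extremePoints_nonempty ⟨u₀, hu₀, rfl⟩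
  obtain ⟨⟨huK, hup⟩, hext⟩ := mem_extremePoints_iff_left.1 hu
  refine ⟨u.toLinearMap, huK, ?_, fun v hv => ?_⟩
  · by_contra hspan
    obtain ⟨w, hw0, hw⟩ := Submodule.exists_le_ker_of_lt_top _ (lt_top_iff_ne_top.2 hspan)
    obtain ⟨ε, hε, hεw⟩ := exists_pos_forall_mul_abs_le hP.finite_extremePoints.toFinset
      (fun x => 1 - u x) w
    have hmem : ∀ s : ℝ, |s| = ε → u + s • w.toContinuousLinearMap ∈ K := fun s hs x hx => by
      simp only [add_apply, smul_apply,
        LinearMap.coe_toContinuousLinearMap', smul_eq_mul]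
      rcases (huK x hx).eq_or_lt with h1 | h1
      · have : w x = 0 := hw (Submodule.subset_span ⟨hx, h1⟩)
        rw [this, h1]; simp
      · have h2 := hεw x (by simpa using hx) (by linarith)
        have h3 := le_abs_self (s * w x)
        rw [abs_mul, hs] at h3
        linarith
    have h1 := hmem ε (abs_of_pos hε)
    have h2 := hmem (-ε) (by rw [abs_neg, abs_of_pos hε])
    have h1' := hmax h1
    have h2' := hmax h2
    simp only [mem_ofPred_eq, add_apply, smul_apply,
      LinearMap.coe_toContinuousLinearMap', smul_eq_mul] at h1' h2' hup
    have hwp : w p = 0 := by nlinarith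
    have h3 := hext _ ⟨h1, by simp [hwp, hup]⟩ _ ⟨h2, by simp [hwp, hup]⟩
      ⟨1 / 2, 1 / 2, by norm_num, by norm_num, by norm_num, by module⟩
    apply hw0
    have h4 : ε • w.toContinuousLinearMap = 0 := by simpa using h3
    rw [smul_eq_zero] at h4
    ext x
    have h5 := h4.resolve_left hε.ne'
    simpa using congrArg (fun f => f x) h5
  · have h := hmax (a := v.toContinuousLinearMap) hv
    simp only [mem_ofPred_eq, LinearMap.coe_toContinuousLinearMap'] at h hup
    rw [ContinuousLinearMap.coe_coe, hup]
    exact h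

variable {X : Finset N}

/-- A facet functional of `P` yields a facet basis of the set `X` of vertices. -/
lemma exists_isFacetBasis (hP : IsSmoothFano N P)
    (hX : ((↑) '' (X : Set N) : Set V) = P.extremePoints ℝ)
    (hV : 0 < finrank ℝ V) (u : V →ₗ[ℝ] ℝ) (hu : ∀ x ∈ P.extremePoints ℝ, u x ≤ 1)
    (hspan : Submodule.span ℝ {x ∈ P.extremePoints ℝ | u x = 1} = ⊤) :
    ∃ b : Basis (Fin (finrank ℝ V)) ℤ N, IsFacetBasis X b ∧ (∀ i, u (b i) = 1) ∧
      Set.range (fun i => (b i : V)) = {x ∈ P.extremePoints ℝ | u x = 1} := by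
  obtain ⟨b, hb⟩ := exists_basis_of_span_eq_top hP hV u hu hspan
  have hmem : ∀ i, (b i : V) ∈ {x ∈ P.extremePoints ℝ | u x = 1} := fun i => hb ▸ mem_range_self i
  have hX' : ∀ x : N, x ∈ X ↔ (x : V) ∈ P.extremePoints ℝ := fun x => by
    rw [← hX, Subtype.val_injective.mem_set_image, Finset.mem_coe]
  have hub : ∀ i, u (b i) = 1 := fun i => (hmem i).2
  refine ⟨b, ⟨fun i => (hX' _).2 (hmem i).1, fun x hx => ?_, fun x hx hx1 => ?_⟩, hub, hb⟩
  · have := hu x ((hX' x).1 hx)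
    rw [← height_eq_of_basis hub] at this
    exact_mod_cast this
  · have : (x : V) ∈ {x ∈ P.extremePoints ℝ | u x = 1} :=
      ⟨(hX' x).1 hx, by rw [← height_eq_of_basis hub, hx1]; simp⟩
    rw [← hb] at this
    obtain ⟨i, hi⟩ := this
    exact ⟨i, Subtype.ext hi⟩

variable [DiscreteTopology N] [IsZLattice ℝ N]

/-- Every lattice point lies in the cone over some facet. -/
lemma exists_isFacetBasis_repr_nonneg (hP : IsSmoothFano N P)
    (hX : ((↑) '' (X : Set N) : Set V) = P.extremePoints ℝ) (hV : 0 < finrank ℝ V) (p : N) :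
    ∃ b : Basis (Fin (finrank ℝ V)) ℤ N, IsFacetBasis X b ∧ ∀ i, 0 ≤ b.repr p i := by
  obtain ⟨u, hu, hspan, hmax⟩ := exists_maximal_functional hP (p : V)
  obtain ⟨b, hb, hub, hrange⟩ := exists_isFacetBasis hP hX hV u hu hspan
  refine ⟨b, hb, fun i => ?_⟩
  by_contra! hi
  set g := (b.ofZLatticeBasis ℝ N).coord i with hg
  have hgb : ∀ j, 0 ≤ g (b j) := fun j => by
    rw [hg, Basis.coord_apply, Basis.ofZLatticeBasis_repr_apply]
    exact_mod_cast repr_basis_nonneg b j i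
  obtain ⟨ε, hε, hεg⟩ := exists_pos_forall_mul_abs_le hP.finite_extremePoints.toFinset
    (fun x => 1 - u x) g
  have h := hmax (u - ε • g) fun x hx => by
    simp only [LinearMap.sub_apply, LinearMap.smul_apply, smul_eq_mul]
    rcases (hu x hx).eq_or_lt with h1 | h1
    · have : x ∈ {x ∈ P.extremePoints ℝ | u x = 1} := ⟨hx, h1⟩
      rw [← hrange] at this
      obtain ⟨j, rfl⟩ := this
      have := mul_nonneg hε.le (hgb j)
      linarith
    · have h2 := hεg x (by simpa using hx) (by linarith)
      have h3 := neg_abs_le (ε * g x)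
      rw [abs_mul, abs_of_pos hε] at h3
      linarith
  have hgp : g p < 0 := by
    rw [hg, Basis.coord_apply, Basis.ofZLatticeBasis_repr_apply]
    exact_mod_cast hi
  simp only [LinearMap.sub_apply, LinearMap.smul_apply, smul_eq_mul] at h
  nlinarith

/-- Pivoting: one may cross any ridge of a facet. -/
lemma exists_exchange_of_isFacetBasis (hP : IsSmoothFano N P)
    (hX : ((↑) '' (X : Set N) : Set V) = P.extremePoints ℝ) (hV : 0 < finrank ℝ V)
    {b : Basis (Fin (finrank ℝ V)) ℤ N} (hb : IsFacetBasis X b) (i : Fin (finrank ℝ V)) :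
    ∃ b' : Basis (Fin (finrank ℝ V)) ℤ N, IsFacetBasis X b' ∧ IsExchange b b' i := by
  classical
  have hX' : ∀ x : N, x ∈ X ↔ (x : V) ∈ P.extremePoints ℝ := fun x => by
    rw [← hX, Subtype.val_injective.mem_set_image, Finset.mem_coe]
  set B := b.ofZLatticeBasis ℝ N with hB
  set g : V →ₗ[ℝ] ℝ := B.coord i with hg
  have hgN : ∀ x : N, g x = b.repr x i := fun x => by
    rw [hg, hB, Basis.coord_apply, Basis.ofZLatticeBasis_repr_apply]
  have hBb : ∀ j, B j = (b j : V) := fun j => b.ofZLatticeBasis_apply ℝ N j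
  set u : V →ₗ[ℝ] ℝ := ∑ j, B.coord j with hu
  have hub : ∀ j, u (b j) = 1 := fun j => by
    rw [← hBb, hu]; simp [Finsupp.single_apply]
  have huN := height_eq_of_basis hub
  -- Some vertex lies on the far side of the ridge; take the first one that is met.
  have hne : (X.filter fun x => b.repr x i < 0).Nonempty := by
    by_contra hcon
    rw [Finset.not_nonempty_iff_eq_empty, Finset.filter_eq_empty_iff] at hcon
    have h0 : -g = 0 := eq_zero_of_nonpos hP.zero_mem_interior (-g)
      (le_of_forall_extremePoints hP _ fun x hx => by
        rw [← hX] at hx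
        obtain ⟨y, hy, rfl⟩ := hx
        have := not_lt.1 (hcon hy)
        rw [LinearMap.neg_apply, hgN]
        exact neg_nonpos.2 (by exact_mod_cast this))
    have := congrArg (fun f => f (b i : V)) h0
    simp [hgN] at this
  obtain ⟨w, hw, hmin⟩ := Finset.exists_min_image _
    (fun x => (1 - (height b x : ℝ)) / -(b.repr x i : ℝ)) hne
  rw [Finset.mem_filter] at hw
  obtain ⟨hwX, hwi⟩ := hw
  have hwi' : (0 : ℝ) < -(b.repr w i : ℝ) := by
    have : (b.repr w i : ℝ) < 0 := by exact_mod_cast hwi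
    linarith
  have hX1 : ∀ x ∈ X, (height b x : ℝ) ≤ 1 := fun x hx => by exact_mod_cast hb.height_le x hx
  set t := (1 - (height b w : ℝ)) / -(b.repr w i : ℝ) with ht
  have ht0 : 0 ≤ t := div_nonneg (by linarith [hX1 w hwX]) hwi'.le
  set u' : V →ₗ[ℝ] ℝ := u - t • g with hu'
  have hu'N : ∀ x : N, u' x = height b x - t * b.repr x i := fun x => by
    rw [hu', huN, ← hgN]; simp
  have hu'X : ∀ x ∈ P.extremePoints ℝ, u' x ≤ 1 := fun x hx => by
    rw [← hX] at hx
    obtain ⟨y, hy, rfl⟩ := hx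
    rw [hu'N]
    rcases lt_or_ge (b.repr y i) 0 with hyi | hyi
    · have h1 := hmin y (Finset.mem_filter.2 ⟨hy, hyi⟩)
      have h2 : (b.repr y i : ℝ) < 0 := by exact_mod_cast hyi
      rw [le_div_iff₀ (by linarith)] at h1
      linarith
    · have h2 : (0 : ℝ) ≤ b.repr y i := by exact_mod_cast hyi
      have := mul_nonneg ht0 h2
      linarith [hX1 y hy]
  have hu'b : ∀ j, j ≠ i → u' (b j) = 1 := fun j hj => by
    rw [hu'N]; simp [hj]
  have hu'w : u' w = 1 := by
    have : t * -(b.repr w i : ℝ) = 1 - height b w := div_mul_cancel₀ _ hwi'.ne'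
    rw [hu'N]
    linarith
  set v : Fin (finrank ℝ V) → N := Function.update b i w with hv
  have hvmem : ∀ j, (v j : V) ∈ {x ∈ P.extremePoints ℝ | u' x = 1} := fun j => by
    by_cases hj : j = i
    · subst hj
      rw [hv, Function.update_self]
      exact ⟨(hX' w).1 hwX, hu'w⟩
    · rw [hv, Function.update_of_ne hj]
      exact ⟨(hX' _).1 (hb.mem j), hu'b j hj⟩
  have hspan : Submodule.span ℝ {x ∈ P.extremePoints ℝ | u' x = 1} = ⊤ := by
    set S := Submodule.span ℝ {x ∈ P.extremePoints ℝ | u' x = 1} with hS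
    have hvS : ∀ j, (v j : V) ∈ S := fun j => Submodule.subset_span (hvmem j)
    have hbS : ∀ j, j ≠ i → B j ∈ S := fun j hj => by
      have := hvS j
      rwa [hv, Function.update_of_ne hj, ← hBb] at this
    have hwS : (w : V) ∈ S := by
      have := hvS i
      rwa [hv, Function.update_self] at this
    rw [← top_le_iff, ← B.span_eq, Submodule.span_le]
    rintro _ ⟨j, rfl⟩
    by_cases hj : j = i
    · subst hj
      have hsum := B.sum_repr (w : V)
      rw [← Finset.add_sum_erase _ _ (Finset.mem_univ j)] at hsum
      have hrest : ∑ l ∈ Finset.univ.erase j, B.repr (w : V) l • B l ∈ S :=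
        Submodule.sum_mem _ fun l hl => S.smul_mem _ (hbS l (Finset.ne_of_mem_erase hl))
      have hc : B.repr (w : V) j ≠ 0 := by
        have := hgN w
        rw [hg, Basis.coord_apply] at this
        rw [this]
        linarith
      have hsm : B.repr (w : V) j • B j ∈ S := by
        rw [eq_sub_of_add_eq hsum]
        exact S.sub_mem hwS hrest
      exact (S.smul_mem_iff hc).1 hsm
    · exact hbS j hj
  obtain ⟨c, hc, -, hrange⟩ := exists_isFacetBasis hP hX hV u' hu'X hspan
  have hwb : ∀ j, b j ≠ w := fun j hj => by
    have := repr_basis_nonneg b j i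
    rw [hj] at this
    omega
  have hvinj : Function.Injective v := by
    intro j l hjl
    by_cases hj : j = i <;> by_cases hl : l = i
    · rw [hj, hl]
    · subst hj
      rw [hv, Function.update_self, Function.update_of_ne hl] at hjl
      exact absurd hjl.symm (hwb l)
    · subst hl
      rw [hv, Function.update_self, Function.update_of_ne hj] at hjl
      exact absurd hjl (hwb j)
    · rw [hv, Function.update_of_ne hl, Function.update_of_ne hj] at hjl
      exact b.injective hjl
  have hσ : ∀ j, ∃ l, c l = v j := fun j => by
    have := hvmem j
    rw [← hrange] at this
    obtain ⟨l, hl⟩ := this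
    exact ⟨l, Subtype.ext hl⟩
  choose σ hσ using hσ
  have hσinj : Function.Injective σ := fun j l hjl => hvinj (by rw [← hσ, ← hσ, hjl])
  set e := Equiv.ofBijective σ (Finite.injective_iff_bijective.1 hσinj) with he
  have hb'v : ∀ j, c.reindex e.symm j = v j := fun j => by
    rw [Basis.reindex_apply, Equiv.symm_symm, he, Equiv.ofBijective_apply, hσ]
  have hheight : ∀ x, height (c.reindex e.symm) x = height c x := fun x => by
    simp only [height_apply, Basis.repr_reindex_apply, Equiv.symm_symm]
    exact e.sum_comp fun j => c.repr x j
  refine ⟨c.reindex e.symm, ⟨fun j => ?_, fun x hx => ?_, fun x hx hx1 => ?_⟩, fun j hj => ?_, ?_⟩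
  · rw [Basis.reindex_apply]; exact hc.mem _
  · rw [hheight]; exact hc.height_le x hx
  · rw [hheight] at hx1
    obtain ⟨l, hl⟩ := hc.eq_of_height x hx hx1
    exact ⟨e.symm l, by simpa using hl⟩
  · rw [hb'v, hv, Function.update_of_ne hj]
  · have hi : c.reindex e.symm i = w := by rw [hb'v, hv, Function.update_self]
    rw [hi]
    -- The coefficient is a unit, since `b i` is an integral combination of the new basis.
    have h1 : (c.reindex e.symm).repr (b i) i * b.repr w i = 1 := by
      have h2 := congrArg (fun x => b.repr x i) ((c.reindex e.symm).sum_repr (b i))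
      rw [map_sum, Finsupp.finsetSum_apply, Finset.sum_eq_single i] at h2
      · rw [hi] at h2; simpa using h2
      · intro j _ hj
        rw [hb'v, hv, Function.update_of_ne hj]
        simp [hj]
      · simp
    rcases Int.isUnit_iff.1 (IsUnit.of_mul_eq_one_right _ h1) with h | h <;> omega

lemma isFanoSystem (hP : IsSmoothFano N P)
    (hX : ((↑) '' (X : Set N) : Set V) = P.extremePoints ℝ) (hV : 0 < finrank ℝ V) :
    IsFanoSystem (Fin (finrank ℝ V)) X where
  zero_notMem := zero_notMem_of_finrank_pos hP hX hV
  exists_exchange _ hb i := exists_exchange_of_isFacetBasis hP hX hV hb i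

end FacetFunctionals

end SmoothFano

/-! ### A criterion for smoothness, and direct sums with hexagons -/

namespace SmoothFano

open Module Set Topology

section Criterion

variable {V : Type*} [NormedAddCommGroup V] [NormedSpace ℝ V]

/-- A set of real linearly independent generators of a lattice is a lattice basis. -/
lemma exists_basis_of_linearIndepOn {M : Submodule ℤ V} {A : Set V} (hA : A.Finite)
    (hli : LinearIndepOn ℝ id A) (htop : Submodule.span ℝ A = ⊤) (hspan : Submodule.span ℤ A = M) :
    ∃ b : Basis (Fin (finrank ℝ V)) ℤ M, Set.range (fun i => (b i : V)) = A := by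
  have := hA.fintype
  have hcard : Fintype.card A = finrank ℝ V := by
    rw [← finrank_top ℝ V, ← htop, finrank_span_set_eq_card hli, Set.toFinset_card]
  have hliZ : LinearIndependent ℤ (fun x : A => (x : V)) :=
    LinearIndependent.restrict_scalars' ℤ (K := ℝ) hli
  have hrange : Submodule.span ℤ (Set.range fun x : A => (x : V)) = M := by
    rw [Subtype.range_coe, hspan]
  let e : A ≃ Fin (finrank ℝ V) := Fintype.equivFinOfCardEq hcard
  refine ⟨((Basis.span hliZ).map (LinearEquiv.ofEq _ _ hrange)).reindex e, ?_⟩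
  have : ∀ i, ((((Basis.span hliZ).map (LinearEquiv.ofEq _ _ hrange)).reindex e i : M) : V) =
      (e.symm i : V) := fun i => by
    rw [Basis.reindex_apply, Basis.map_apply, LinearEquiv.coe_ofEq_apply, Basis.span_apply]
  simp_rw [this]
  ext x
  constructor
  · rintro ⟨i, rfl⟩; exact (e.symm i).2
  · exact fun hx => ⟨e ⟨x, hx⟩, by simp⟩

variable [FiniteDimensional ℝ V]

/-- A criterion for smoothness in terms of the linear functionals that define the facets. -/
lemma isSmoothFano_of_forall_functional {M : Submodule ℤ V} {S : Finset V}
    (hS : ∀ x ∈ S, x ∈ M) (h0 : (0 : V) ∈ interior (convexHull ℝ (S : Set V)))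
    (h : ∀ u : V →ₗ[ℝ] ℝ, (∀ x ∈ S, u x ≤ 1) → Submodule.span ℝ {x | x ∈ S ∧ u x = 1} = ⊤ →
      LinearIndepOn ℝ id {x | x ∈ S ∧ u x = 1} ∧ Submodule.span ℤ {x | x ∈ S ∧ u x = 1} = M) :
    IsSmoothFano M (convexHull ℝ (S : Set V)) where
  polytope := ⟨S, rfl⟩
  lattice x hx := hS x (extremePoints_convexHull_subset hx)
  zero_mem_interior := h0
  facet_basis F hF := by
    obtain ⟨hexp, hne, hrank⟩ := hF
    set P := convexHull ℝ (S : Set V) with hP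
    obtain ⟨l, hl⟩ := hexp hne
    obtain ⟨x₀, hx₀⟩ := hne
    have hx₀' := hx₀
    rw [hl] at hx₀'
    have hlF : ∀ x ∈ F, x ∈ P ∧ l x = l x₀ := fun x hx => by
      rw [hl] at hx
      exact ⟨hx.1, le_antisymm (hx₀'.2 x hx.1) (hx.2 x₀ hx₀'.1)⟩
    have hc0 : 0 ≤ l x₀ := by simpa using hx₀'.2 0 (interior_subset h0)
    have hc : l x₀ ≠ 0 := fun hc => by
      have hz : (l : V →ₗ[ℝ] ℝ) = 0 := eq_zero_of_nonpos h0 _ fun x hx => hc ▸ hx₀'.2 x hx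
      have hz' : ∀ x, l x = 0 := fun x => congrArg (fun f => f x) hz
      have hFP : F = P := by
        rw [hl]
        exact Subset.antisymm (fun x hx => hx.1) fun x hx => ⟨hx, fun y _ => by simp [hz']⟩
      rw [hFP] at hrank
      omega
    set u : V →ₗ[ℝ] ℝ := (l x₀)⁻¹ • (l : V →ₗ[ℝ] ℝ) with hu
    have hux : ∀ x, u x = (l x₀)⁻¹ * l x := fun x => rfl
    have huF : ∀ x ∈ F, u x = 1 := fun x hx => by
      rw [hux, (hlF x hx).2, inv_mul_cancel₀ hc]
    have huS : ∀ x ∈ S, u x ≤ 1 := fun x hx => by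
      have := hx₀'.2 x (subset_convexHull ℝ _ hx)
      rw [hux, ← inv_mul_cancel₀ hc]
      gcongr
    have hPc : IsCompact P := S.finite_toSet.isCompact_convexHull (𝕜 := ℝ)
    have hextS : F.extremePoints ℝ ⊆ {x | x ∈ S ∧ u x = 1} := fun x hx =>
      ⟨extremePoints_convexHull_subset (hexp.isExtreme.extremePoints_subset_extremePoints hx),
        huF x hx.1⟩
    have hSfin : {x | x ∈ S ∧ u x = 1}.Finite := S.finite_toSet.subset fun x hx => hx.1
    have hFhull : convexHull ℝ (F.extremePoints ℝ) = F := by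
      rw [← ((hSfin.subset hextS).isClosed_convexHull (𝕜 := ℝ)).closure_eq]
      exact closure_convexHull_extremePoints (hexp.isCompact hPc)
        (hexp.convex (convex_convexHull ℝ _))
    have hspanF : Submodule.span ℝ F = ⊤ := by
      apply Submodule.eq_top_of_finrank_eq
      rw [finrank_span_eq_finrank_vectorSpan_add_one ⟨x₀, hx₀⟩ u huF, hrank, vectorSpan_eq_top h0,
        finrank_top]
    have hspanE : Submodule.span ℝ (F.extremePoints ℝ) = ⊤ := by
      rw [← top_le_iff, ← hspanF, Submodule.span_le]
      conv_lhs => rw [← hFhull]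
      exact convexHull_min Submodule.subset_span (Submodule.convex _)
    have hspanA : Submodule.span ℝ {x | x ∈ S ∧ u x = 1} = ⊤ :=
      top_le_iff.1 (hspanE.ge.trans (Submodule.span_mono hextS))
    obtain ⟨hli, hspanZ⟩ := h u huS hspanA
    obtain ⟨b, hb⟩ := exists_basis_of_linearIndepOn hSfin hli hspanA hspanZ
    refine ⟨b, hb.trans (Subset.antisymm (fun x hx => ?_) hextS)⟩
    -- A proper subset of a basis does not span.
    by_contra hxE
    have hli' : LinearIndepOn ℝ id (insert x (F.extremePoints ℝ)) :=
      hli.mono (insert_subset hx hextS)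
    have := hli'.notMem_span_of_insert hxE
    rw [image_id, hspanE] at this
    exact this trivial

end Criterion

section Lattices

lemma mem_stdLattice {n : ℕ} {x : Fin n → ℝ} : x ∈ stdLattice n ↔ ∀ i, ∃ z : ℤ, (z : ℝ) = x i := by
  rw [stdLattice, Basis.mem_span_iff_repr_mem]
  simp

lemma mem_latticePow {V : Type*} [NormedAddCommGroup V] [NormedSpace ℝ V] {N : Submodule ℤ V}
    {m : ℕ} {x : Fin m → V} : x ∈ latticePow N m ↔ ∀ t, x t ∈ N := by
  simp [latticePow]

/-- The vertices of the hexagon. -/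
def hexagonVertices : Set (Fin 2 → ℝ) :=
  {![1, 0], ![0, 1], ![-1, 1], ![-1, 0], ![0, -1], ![1, -1]}

lemma hexagon_eq : hexagon = convexHull ℝ hexagonVertices := rfl

lemma sum_le_one_of_mem_hexagonVertices {h : Fin 2 → ℝ} (hh : h ∈ hexagonVertices) :
    h 0 + h 1 ≤ 1 := by
  rcases hh with rfl | rfl | rfl | rfl | rfl | rfl <;> simp

end Lattices

section Splitting

variable {V : Type*} [NormedAddCommGroup V] [NormedSpace ℝ V]
  {N : Submodule ℤ V} {P : Set V} {e f : ℕ}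

/-- If all vertices of `P` belong to one of the two summands of a direct sum decomposition of `V`,
and those in the second one are the vertices of the hexagons, then `P` is a direct sum. -/
lemma freeSum_eq_image (ψ : V →ₗ[ℝ] (Fin e → ℝ) × (Fin f → Fin 2 → ℝ))
    {E : Set V} (hE : convexHull ℝ E = P) (h0 : (0 : V) ∈ P)
    (h1 : ∀ x ∈ E, (ψ x).2 = 0 ∨ ∃ t, ∃ w ∈ hexagonVertices, ψ x = (0, Pi.single t w))
    (h2 : ∀ t, ∀ w ∈ hexagonVertices, ∃ x ∈ E, ψ x = (0, Pi.single t w)) :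
    freeSum (Prod.fst '' (ψ '' P)) (freePow hexagon f) = ψ '' P := by
  have hconv : Convex ℝ (ψ '' P) := by
    rw [← hE]; exact (convex_convexHull ℝ E).linear_image ψ
  have hzero : (0 : (Fin e → ℝ) × (Fin f → Fin 2 → ℝ)) ∈ ψ '' P := ⟨0, h0, map_zero ψ⟩
  have hEP : E ⊆ P := hE ▸ subset_convexHull ℝ E
  apply Subset.antisymm
  · refine convexHull_min (union_subset ?_ ?_) hconv
    · rintro ⟨q, z⟩ ⟨⟨r, ⟨x, hx, rfl⟩, hr⟩, hz⟩
      simp only [mem_singleton_iff] at hz hr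
      subst hz hr
      rw [← hE] at hx
      refine convexHull_min (t := ((LinearMap.inl ℝ (Fin e → ℝ) (Fin f → Fin 2 → ℝ)).comp
        ((LinearMap.fst ℝ _ _).comp ψ)) ⁻¹' (ψ '' P)) (fun y hy => ?_)
        (hconv.linear_preimage _) hx
      rcases h1 y hy with h | ⟨t, w, hw, h⟩
      · refine ⟨y, hEP hy, ?_⟩
        ext1
        · rfl
        · exact h
      · have : (ψ y).1 = 0 := by rw [h]
        simpa [this, ← Prod.zero_eq_mk] using hzero
    · rintro ⟨y, z⟩ ⟨hy, hz⟩
      simp only [mem_singleton_iff] at hy hz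
      subst hy
      refine convexHull_min (t := (LinearMap.inr ℝ (Fin e → ℝ) (Fin f → Fin 2 → ℝ)) ⁻¹' (ψ '' P))
        (union_subset ?_ (iUnion_subset fun t => ?_)) (hconv.linear_preimage _) hz
      · rintro _ rfl
        simpa [← Prod.zero_eq_mk] using hzero
      · rintro _ ⟨q, hq, rfl⟩
        rw [hexagon_eq] at hq
        refine convexHull_min (t := ((LinearMap.inr ℝ (Fin e → ℝ) (Fin f → Fin 2 → ℝ)).comp
          (LinearMap.single ℝ (fun _ : Fin f => Fin 2 → ℝ) t)) ⁻¹' (ψ '' P)) (fun w hw => ?_)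
          (hconv.linear_preimage _) hq
        obtain ⟨x, hx, hxψ⟩ := h2 t w hw
        exact ⟨x, hEP hx, by simpa using hxψ⟩
  · conv_lhs => rw [← hE]
    rw [LinearMap.image_convexHull]
    refine convexHull_min ?_ (convex_convexHull ℝ _)
    rintro _ ⟨x, hx, rfl⟩
    apply subset_convexHull ℝ _
    rcases h1 x hx with h | ⟨t, w, hw, h⟩
    · exact Or.inl ⟨⟨ψ x, ⟨x, hEP hx, rfl⟩, rfl⟩, h⟩
    · refine Or.inr ⟨by rw [h]; rfl, ?_⟩
      rw [h]
      apply subset_convexHull ℝ _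
      exact Or.inr (mem_iUnion.2 ⟨t, w, subset_convexHull ℝ _ hw, rfl⟩)

end Splitting

end SmoothFano

/-! ### Smoothness of the complementary summand -/

namespace SmoothFano

open Module Set Topology

section Splitting

variable {V : Type*} [NormedAddCommGroup V] [NormedSpace ℝ V] [FiniteDimensional ℝ V]
  {N : Submodule ℤ V} {P : Set V} {e f : ℕ}

/-- The complementary summand of a sum of hexagons is smooth: a facet of it, together with an edge
of each hexagon, spans a facet of the direct sum. -/
lemma isSmoothFano_image_fst (hP : IsSmoothFano N P) (hV : 0 < finrank ℝ V)
    (ψ : V ≃ₗ[ℝ] (Fin e → ℝ) × (Fin f → Fin 2 → ℝ))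
    (hN : ∀ x, x ∈ N ↔ (ψ x).1 ∈ stdLattice e ∧ (ψ x).2 ∈ latticePow (stdLattice 2) f)
    (h1 : ∀ x ∈ P.extremePoints ℝ,
      (ψ x).2 = 0 ∨ ∃ t, ∃ w ∈ hexagonVertices, ψ x = (0, Pi.single t w))
    (h2 : ∀ t, ∀ w ∈ hexagonVertices, ∃ x ∈ P.extremePoints ℝ, ψ x = (0, Pi.single t w)) :
    IsSmoothFano (stdLattice e) (Prod.fst '' (ψ '' P)) := by
  classical
  set L : V →ₗ[ℝ] (Fin e → ℝ) := (LinearMap.fst ℝ _ _).comp ψ.toLinearMap with hL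
  have hLx : ∀ x, L x = (ψ x).1 := fun x => rfl
  have hLsymm : ∀ y, L (ψ.symm (y, 0)) = y := fun y => by rw [hLx, ψ.apply_symm_apply]
  obtain ⟨S, hS⟩ : ∃ S : Finset (Fin e → ℝ), (S : Set (Fin e → ℝ)) = L '' P.extremePoints ℝ :=
    ⟨(hP.finite_extremePoints.image L).toFinset, by simp⟩
  have hmemS : ∀ y, y ∈ S ↔ ∃ x ∈ P.extremePoints ℝ, L x = y := fun y => by
    rw [← Finset.mem_coe, hS]; rfl
  have hQ : Prod.fst '' (ψ '' P) = convexHull ℝ (S : Set (Fin e → ℝ)) := by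
    rw [hS, ← LinearMap.image_convexHull, hP.convexHull_extremePoints, image_image]
    rfl
  rw [hQ]
  refine isSmoothFano_of_forall_functional (fun y hy => ?_) ?_ fun u hu hspan => ?_
  · obtain ⟨x, hx, rfl⟩ := (hmemS y).1 hy
    exact ((hN x).1 (hP.lattice x hx)).1
  · rw [← hQ]
    have hopen : IsOpenMap L := L.isOpenMap_of_finiteDimensional fun y => ⟨_, hLsymm y⟩
    have := hopen.image_interior_subset P ⟨0, hP.zero_mem_interior, map_zero L⟩
    rwa [show L '' P = Prod.fst '' (ψ '' P) by rw [image_image]; rfl] at this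
  -- Extend `u` by the functionals of an edge of each hexagon.
  set η : V →ₗ[ℝ] ℝ := ∑ t : Fin f, ∑ s : Fin 2, (LinearMap.proj s).comp ((LinearMap.proj t).comp
    ((LinearMap.snd ℝ (Fin e → ℝ) (Fin f → Fin 2 → ℝ)).comp ψ.toLinearMap)) with hη
  have hηx : ∀ x, η x = ∑ t, ((ψ x).2 t 0 + (ψ x).2 t 1) := fun x => by
    simp [hη, LinearMap.sum_apply]
  set u' : V →ₗ[ℝ] ℝ := u.comp L + η with hu'
  have hu'x : ∀ x, u' x = u (L x) + η x := fun x => rfl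
  have hη0 : ∀ x, (ψ x).2 = 0 → u' x = u (L x) := fun x hx => by rw [hu'x, hηx, hx]; simp
  have hη1 : ∀ x t w, ψ x = (0, Pi.single t w) → L x = 0 ∧ u' x = w 0 + w 1 :=
    fun x t w hx => by
      have hLx0 : L x = 0 := by rw [hLx, hx]
      refine ⟨hLx0, ?_⟩
      rw [hu'x, hLx0, hηx, hx, Finset.sum_eq_single t]
      · simp
      · intro t' _ ht'; simp [ht']
      · simp
  have hu'P : ∀ x ∈ P.extremePoints ℝ, u' x ≤ 1 := fun x hx => by
    rcases h1 x hx with h | ⟨t, w, hw, h⟩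
    · rw [hη0 x h]; exact hu _ ((hmemS _).2 ⟨x, hx, rfl⟩)
    · rw [(hη1 x t w h).2]; exact sum_le_one_of_mem_hexagonVertices hw
  -- The vertices on the facet of `u` lift to vertices on the facet of `u'`.
  have hlift : ∀ y ∈ {y | y ∈ S ∧ u y = 1},
      ψ.symm (y, 0) ∈ {x ∈ P.extremePoints ℝ | u' x = 1} := by
    rintro y ⟨hy, huy⟩
    obtain ⟨x, hx, rfl⟩ := (hmemS y).1 hy
    rcases h1 x hx with h | ⟨t, w, hw, h⟩
    · have hxe : ψ.symm (L x, 0) = x := by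
        rw [LinearEquiv.symm_apply_eq, hLx, ← h]
      rw [hxe]
      exact ⟨hx, (hη0 x h).trans huy⟩
    · rw [(hη1 x t w h).1, map_zero] at huy
      exact absurd huy zero_ne_one
  have hdown : ∀ x ∈ {x ∈ P.extremePoints ℝ | u' x = 1},
      L x = 0 ∨ L x ∈ {y | y ∈ S ∧ u y = 1} := by
    rintro x ⟨hx, hux⟩
    rcases h1 x hx with h | ⟨t, w, hw, h⟩
    · exact Or.inr ⟨(hmemS _).2 ⟨x, hx, rfl⟩, (hη0 x h).symm.trans hux⟩
    · exact Or.inl (hη1 x t w h).1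
  have hspan' : Submodule.span ℝ {x ∈ P.extremePoints ℝ | u' x = 1} = ⊤ := by
    set T := Submodule.span ℝ {x ∈ P.extremePoints ℝ | u' x = 1} with hT
    have hA : ∀ y, ψ.symm (y, 0) ∈ T := fun y => by
      have : (⊤ : Submodule ℝ (Fin e → ℝ)) ≤
          T.comap (ψ.symm.toLinearMap.comp (LinearMap.inl ℝ _ _)) := by
        rw [← hspan, Submodule.span_le]
        exact fun y hy => Submodule.subset_span (hlift y hy)
      exact this (Submodule.mem_top (x := y))
    have hB : ∀ t w, w ∈ hexagonVertices → w 0 + w 1 = 1 →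
        ψ.symm (0, Pi.single t w) ∈ T := fun t w hw hw1 => by
      obtain ⟨x, hx, hxψ⟩ := h2 t w hw
      rw [← hxψ, ψ.symm_apply_apply]
      exact Submodule.subset_span ⟨hx, (hη1 x t w hxψ).2.trans hw1⟩
    have hC : ∀ t w, ψ.symm (0, Pi.single t w) ∈ T := fun t w => by
      have hw : w = w 0 • ![1, 0] + w 1 • ![0, 1] := by
        ext s; fin_cases s <;> simp
      have hsum : ((0, Pi.single t w) : (Fin e → ℝ) × (Fin f → Fin 2 → ℝ)) =
          w 0 • (0, Pi.single t ![1, 0]) + w 1 • (0, Pi.single t ![0, 1]) := by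
        conv_lhs => rw [hw]
        simp only [Prod.smul_mk, Prod.mk_add_mk, smul_zero, add_zero, Pi.single_add,
          Pi.single_smul]
      rw [hsum, map_add, map_smul, map_smul]
      exact T.add_mem (T.smul_mem _ (hB t _ (by simp [hexagonVertices]) (by simp)))
        (T.smul_mem _ (hB t _ (by simp [hexagonVertices]) (by simp)))
    rw [eq_top_iff]
    intro v _
    have hv : v = ψ.symm ((ψ v).1, 0) + ∑ t, ψ.symm (0, Pi.single t ((ψ v).2 t)) := by
      rw [← map_sum, ← map_add, eq_comm, LinearEquiv.symm_apply_eq]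
      ext1
      · simp [Prod.fst_sum]
      · simp [Prod.snd_sum, Finset.univ_sum_single]
    rw [hv]
    exact T.add_mem (hA _) (T.sum_mem fun t _ => hC t _)
  obtain ⟨c, hc⟩ := exists_basis_of_span_eq_top hP hV u' hu'P hspan'
  have hcli : LinearIndependent ℝ (fun i => (c i : V)) :=
    linearIndependent_of_top_le_span_of_card_eq_finrank (by rw [hc, hspan']) (by simp)
  constructor
  · have hidx : ∀ y : {y | y ∈ S ∧ u y = 1}, ∃ i, (c i : V) = ψ.symm (y, 0) := fun y => by
      have := hlift y y.2
      rwa [← hc] at this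
    choose i hi using hidx
    have hinj : Function.Injective i := fun y z hyz => by
      have := hi y
      rw [hyz, hi z] at this
      have := ψ.symm.injective this
      exact Subtype.ext (congrArg Prod.fst this).symm
    have := hcli.comp i hinj
    refine LinearIndependent.of_comp (ψ.symm.toLinearMap.comp (LinearMap.inl ℝ _ _)) ?_
    convert! this using 1
    ext y
    exact (hi y).symm
  · apply le_antisymm
    · rw [Submodule.span_le]
      rintro y ⟨hy, -⟩
      obtain ⟨x, hx, rfl⟩ := (hmemS y).1 hy
      exact ((hN x).1 (hP.lattice x hx)).1
    · intro z hz
      have hzN : ψ.symm (z, 0) ∈ N := by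
        rw [hN, ψ.apply_symm_apply]
        exact ⟨hz, Submodule.zero_mem _⟩
      have hsum := congrArg (fun x : N => L x) (c.sum_repr ⟨_, hzN⟩)
      simp only [hLsymm] at hsum
      rw [← hsum, AddSubmonoidClass.coe_finsetSum, map_sum]
      refine Submodule.sum_mem _ fun i _ => ?_
      rw [Submodule.coe_smul, map_zsmul]
      refine Submodule.smul_mem _ _ ?_
      rcases hdown (c i) (hc ▸ mem_range_self i) with h | h
      · rw [h]; exact Submodule.zero_mem _
      · exact Submodule.subset_span h

end Splitting

end SmoothFano

/-! ### Splitting off the hexagons -/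

namespace SmoothFano

open Module Set Topology

section Assembly

variable {V : Type*} [NormedAddCommGroup V] [NormedSpace ℝ V] [FiniteDimensional ℝ V]
  {N : Submodule ℤ V} [DiscreteTopology N] [IsZLattice ℝ N] {P : Set V} {e f : ℕ}

/-- The coordinates with respect to a lattice basis, arranged according to a partition of the
indices into `e` single ones and `f` pairs. -/
noncomputable def splitEquiv {ι : Type*} [Fintype ι] (b : Basis ι ℤ N)
    (σ : Fin e ⊕ (Fin f × Fin 2) ≃ ι) : V ≃ₗ[ℝ] (Fin e → ℝ) × (Fin f → Fin 2 → ℝ) :=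
  (b.ofZLatticeBasis ℝ N).equivFun ≪≫ₗ LinearEquiv.funCongrLeft ℝ ℝ σ ≪≫ₗ
    LinearEquiv.sumArrowLequivProdArrow (Fin e) (Fin f × Fin 2) ℝ ℝ ≪≫ₗ
    (LinearEquiv.refl ℝ (Fin e → ℝ)).prodCongr (LinearEquiv.curry ℝ ℝ (Fin f) (Fin 2))

variable {ι : Type*} [Fintype ι] (b : Basis ι ℤ N) (σ : Fin e ⊕ (Fin f × Fin 2) ≃ ι)

lemma splitEquiv_fst (x : V) (a : Fin e) :
    (splitEquiv b σ x).1 a = (b.ofZLatticeBasis ℝ N).repr x (σ (Sum.inl a)) := rfl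

lemma splitEquiv_snd (x : V) (t : Fin f) (s : Fin 2) :
    (splitEquiv b σ x).2 t s = (b.ofZLatticeBasis ℝ N).repr x (σ (Sum.inr (t, s))) := rfl

lemma mem_iff_splitEquiv_mem (x : V) : x ∈ N ↔
    (splitEquiv b σ x).1 ∈ stdLattice e ∧
      (splitEquiv b σ x).2 ∈ latticePow (stdLattice 2) f := by
  have h : x ∈ N ↔ ∀ i, ∃ z : ℤ, (z : ℝ) = (b.ofZLatticeBasis ℝ N).repr x i := by
    conv_lhs => rw [← b.ofZLatticeBasis_span ℝ, Basis.mem_span_iff_repr_mem]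
    rfl
  rw [h, mem_stdLattice, mem_latticePow]
  simp only [mem_stdLattice, splitEquiv_fst, splitEquiv_snd]
  constructor
  · exact fun h => ⟨fun a => h _, fun t s => h _⟩
  · rintro ⟨h1, h2⟩ i
    obtain ⟨a | ⟨t, s⟩, rfl⟩ := σ.surjective i
    · exact h1 a
    · exact h2 t s

lemma splitEquiv_pair (t : Fin f) (p q : ℝ) :
    splitEquiv b σ (p • (b (σ (Sum.inr (t, 0))) : V) + q • (b (σ (Sum.inr (t, 1))) : V)) =
      (0, Pi.single t ![p, q]) := by
  classical
  simp only [← b.ofZLatticeBasis_apply ℝ N]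
  ext a s
  · rw [splitEquiv_fst]
    simp
  · rw [splitEquiv_snd]
    by_cases hts : a = t
    · subst hts
      fin_cases s <;> simp
    · simp [hts]

/-- If the indices of a lattice basis `b` can be arranged into single ones and pairs such that each
pair generates a hexagon of vertices, and no other vertex has a nonzero coordinate at the pair, then
the hexagons split off. -/
lemma exists_latticeEquivalent_freeSum (hP : IsSmoothFano N P) {X : Finset N}
    (hX : ((↑) '' (X : Set N) : Set V) = P.extremePoints ℝ) (hV : 0 < finrank ℝ V)
    (h2 : ∀ t, b (σ (Sum.inr (t, 0))) ∈ X ∧ b (σ (Sum.inr (t, 1))) ∈ X ∧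
      -b (σ (Sum.inr (t, 0))) ∈ X ∧ -b (σ (Sum.inr (t, 1))) ∈ X ∧
      b (σ (Sum.inr (t, 1))) - b (σ (Sum.inr (t, 0))) ∈ X ∧
      b (σ (Sum.inr (t, 0))) - b (σ (Sum.inr (t, 1))) ∈ X)
    (h1 : ∀ x ∈ X, ∀ t s, b.repr x (σ (Sum.inr (t, s))) ≠ 0 →
      x = b (σ (Sum.inr (t, 0))) ∨ x = b (σ (Sum.inr (t, 1))) ∨
      x = -b (σ (Sum.inr (t, 0))) ∨ x = -b (σ (Sum.inr (t, 1))) ∨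
      x = b (σ (Sum.inr (t, 1))) - b (σ (Sum.inr (t, 0))) ∨
      x = b (σ (Sum.inr (t, 0))) - b (σ (Sum.inr (t, 1)))) :
    ∃ Q : Set (Fin e → ℝ), IsSmoothFano (stdLattice e) Q ∧
      LatticeEquivalent N ((stdLattice e).prod (latticePow (stdLattice 2) f))
        P (freeSum Q (freePow hexagon f)) := by
  set ψ := splitEquiv b σ with hψ
  have hpair := splitEquiv_pair b σ
  have h1' : ∀ x ∈ P.extremePoints ℝ,
      (ψ x).2 = 0 ∨ ∃ t, ∃ w ∈ hexagonVertices, ψ x = (0, Pi.single t w) := by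
    intro x hx
    rw [← hX] at hx
    obtain ⟨x, hx, rfl⟩ := hx
    by_cases hz : ∀ t s, b.repr x (σ (Sum.inr (t, s))) = 0
    · left
      ext t s
      rw [hψ, splitEquiv_snd, Basis.ofZLatticeBasis_repr_apply, hz t s]
      simp
    · push Not at hz
      obtain ⟨t, s, hts⟩ := hz
      refine Or.inr ⟨t, ?_⟩
      rcases h1 x hx t s hts with rfl | rfl | rfl | rfl | rfl | rfl
      · exact ⟨![1, 0], by simp [hexagonVertices], by simpa using hpair t 1 0⟩
      · exact ⟨![0, 1], by simp [hexagonVertices], by simpa using hpair t 0 1⟩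
      · exact ⟨![-1, 0], by simp [hexagonVertices], by simpa using hpair t (-1) 0⟩
      · exact ⟨![0, -1], by simp [hexagonVertices], by simpa using hpair t 0 (-1)⟩
      · refine ⟨![-1, 1], by simp [hexagonVertices], ?_⟩
        rw [← hpair t (-1) 1, hψ]
        congr 1
        push_cast
        module
      · refine ⟨![1, -1], by simp [hexagonVertices], ?_⟩
        rw [← hpair t 1 (-1), hψ]
        congr 1
        push_cast
        module
  have h2' : ∀ t, ∀ w ∈ hexagonVertices,
      ∃ x ∈ P.extremePoints ℝ, ψ x = (0, Pi.single t w) := by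
    intro t w hw
    have hmem : ∀ x ∈ X, (x : V) ∈ P.extremePoints ℝ := fun x hx => hX ▸ ⟨x, hx, rfl⟩
    obtain ⟨m1, m2, m3, m4, m5, m6⟩ := h2 t
    rcases hw with rfl | rfl | rfl | rfl | rfl | rfl
    · exact ⟨_, hmem _ m1, by simpa using hpair t 1 0⟩
    · exact ⟨_, hmem _ m2, by simpa using hpair t 0 1⟩
    · refine ⟨_, hmem _ m5, ?_⟩
      rw [← hpair t (-1) 1, hψ]
      congr 1
      push_cast
      module
    · exact ⟨_, hmem _ m3, by simpa using hpair t (-1) 0⟩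
    · exact ⟨_, hmem _ m4, by simpa using hpair t 0 (-1)⟩
    · refine ⟨_, hmem _ m6, ?_⟩
      rw [← hpair t 1 (-1), hψ]
      congr 1
      push_cast
      module
  refine ⟨Prod.fst '' (ψ '' P),
    isSmoothFano_image_fst hP hV ψ (mem_iff_splitEquiv_mem b σ) h1' h2', ?_⟩
  have hsum : freeSum (Prod.fst '' (ψ '' P)) (freePow hexagon f) = ψ '' P :=
    freeSum_eq_image ψ.toLinearMap hP.convexHull_extremePoints
      (interior_subset hP.zero_mem_interior) h1' h2'
  refine ⟨ψ.toAffineEquiv, ?_, ?_⟩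
  · ext y
    simp only [LinearEquiv.coe_toAffineEquiv, mem_image, SetLike.mem_coe, Submodule.mem_prod]
    constructor
    · rintro ⟨x, hx, rfl⟩
      exact (mem_iff_splitEquiv_mem b σ x).1 hx
    · exact fun hy => ⟨ψ.symm y, (mem_iff_splitEquiv_mem b σ _).2
        (by rwa [← hψ, ψ.apply_symm_apply]), ψ.apply_symm_apply y⟩
  · rw [hsum, ← image_extremePoints, LinearEquiv.coe_toAffineEquiv]

end Assembly

/-- A set that carries a fixed-point-free involution `φ` contains a transversal, half its size. -/
lemma exists_transversal {ι : Type*} [LinearOrder ι] {T : Finset ι} {φ : ι → ι}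
    (h : ∀ i ∈ T, φ i ∈ T ∧ φ i ≠ i ∧ φ (φ i) = i) :
    ∃ R ⊆ T, T.card = 2 * R.card ∧ ∀ i ∈ R, φ i ∉ R := by
  refine ⟨T.filter fun i => i < φ i, Finset.filter_subset _ _, ?_, fun i hi hi' => ?_⟩
  · have h1 : (T.filter fun i => i < φ i).card = (T.filter fun i => ¬ i < φ i).card := by
      refine Finset.card_nbij' φ φ (fun i hi => ?_) (fun i hi => ?_)
        (fun i hi => (h i (Finset.mem_filter.1 hi).1).2.2)
        (fun i hi => (h i (Finset.mem_filter.1 hi).1).2.2)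
      · obtain ⟨hT, hlt⟩ := Finset.mem_filter.1 hi
        refine Finset.mem_coe.2 (Finset.mem_filter.2 ⟨(h i hT).1, ?_⟩)
        rw [(h i hT).2.2]
        exact hlt.asymm
      · obtain ⟨hT, hlt⟩ := Finset.mem_filter.1 hi
        refine Finset.mem_coe.2 (Finset.mem_filter.2 ⟨(h i hT).1, ?_⟩)
        rw [(h i hT).2.2]
        exact lt_of_le_of_ne (not_lt.1 hlt) (h i hT).2.1
    have h2 := Finset.card_filter_add_card_filter_not (s := T) (fun i => i < φ i)
    omega
  · obtain ⟨hT, hlt⟩ := Finset.mem_filter.1 hi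
    obtain ⟨-, hlt'⟩ := Finset.mem_filter.1 hi'
    rw [(h i hT).2.2] at hlt'
    exact hlt.asymm hlt'

/-- An injection extends to a bijection from a disjoint union. -/
lemma exists_sum_equiv {ι κ : Type*} [Fintype ι] [Fintype κ] {J : κ → ι}
    (hJ : Function.Injective J) {e : ℕ} (he : e + Fintype.card κ = Fintype.card ι) :
    ∃ σ : Fin e ⊕ κ ≃ ι, ∀ a, σ (Sum.inr a) = J a := by
  classical
  have h1 : Fintype.card (Set.range J) = Fintype.card κ := Set.card_range_of_injective hJ
  have h2 : Fintype.card ((Set.range J)ᶜ : Set ι) = e := by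
    rw [Fintype.card_compl_set, h1]; omega
  refine ⟨((Fintype.equivFinOfCardEq h2).symm.sumCongr (Equiv.ofInjective J hJ)).trans
    ((Equiv.sumComm _ _).trans (Equiv.Set.sumCompl (Set.range J))), fun a => ?_⟩
  simp

lemma two_mul_splitNumber_le {d k : ℕ} (h : 15 * k ^ 2 + 37 * k + 2 ≤ d) :
    2 * splitNumber d k + (15 * k ^ 2 + 37 * k) ≤ d := by
  have h' : ((15 * k ^ 2 + 37 * k + 2 : ℕ) : ℚ) ≤ d := by exact_mod_cast h
  push_cast at h'
  have hfl : (splitNumber d k : ℚ) ≤ ((d : ℚ) - 15 * (k : ℚ) ^ 2 - 37 * (k : ℚ)) / 2 :=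
    Nat.floor_le (by linarith)
  have : ((2 * splitNumber d k + (15 * k ^ 2 + 37 * k) : ℕ) : ℚ) ≤ d := by
    push_cast; linarith
  exact_mod_cast this

end SmoothFano

open SmoothFano in
theorem theorem1p2 {V : Type*} [NormedAddCommGroup V] [NormedSpace ℝ V] [FiniteDimensional ℝ V]
    (N : Submodule ℤ V) [DiscreteTopology N] [IsZLattice ℝ N] (d k : ℕ)
    (hd : Module.finrank ℝ V = d) (P : Set V) (hP : IsSmoothFano N P)
    (hcard : (P.extremePoints ℝ).ncard + k = 3 * d)
    (hdk : 15 * k ^ 2 + 37 * k + 2 ≤ d) :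
    ∃ (e : ℕ) (Q : Set (Fin e → ℝ)),
      e + 2 * splitNumber d k = d ∧
      IsSmoothFano (stdLattice e) Q ∧
      LatticeEquivalent N ((stdLattice e).prod (latticePow (stdLattice 2) (splitNumber d k)))
        P (freeSum Q (freePow hexagon (splitNumber d k))) := by
  classical
  have hV : 0 < Module.finrank ℝ V := by omega
  obtain ⟨X, hX⟩ := hP.exists_finset
  have hXcard : X.card + k = 3 * Fintype.card (Fin (Module.finrank ℝ V)) := by
    rw [Fintype.card_fin, hd, ← hcard, ← hX, Set.ncard_image_of_injective _ Subtype.val_injective,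
      Set.ncard_coe_finset]
  obtain ⟨b, hb, hsum⟩ := exists_isFacetBasis_repr_nonneg hP hX hV (∑ x ∈ X, x)
  obtain ⟨T, φ, hT, hφ⟩ := exists_hexagon_pairs (isFanoSystem hP hX hV) hb hXcard hsum
  obtain ⟨R, hRT, hTR, hR⟩ := exists_transversal fun i hi =>
    ⟨(hφ i hi).1, (hφ i hi).2.1, (hφ i hi).2.2.1⟩
  have hf := two_mul_splitNumber_le hdk
  rw [Fintype.card_fin] at hT
  obtain ⟨R', hR'R, hR'⟩ := Finset.exists_subset_card_eq (s := R) (n := splitNumber d k) (by omega)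
  set τ := R'.orderEmbOfFin hR' with hτ
  have hτR : ∀ t, τ t ∈ R := fun t => hR'R (R'.orderEmbOfFin_mem hR' t)
  have hτT : ∀ t, τ t ∈ T := fun t => hRT (hτR t)
  set J : Fin (splitNumber d k) × Fin 2 → Fin (Module.finrank ℝ V) :=
    fun a => if a.2 = 0 then τ a.1 else φ (τ a.1) with hJ
  have hJinj : Function.Injective J := by
    have hne : ∀ t t', τ t ≠ φ (τ t') := fun t t' h => hR _ (hτR t') (h ▸ hτR t)
    rintro ⟨t, s⟩ ⟨t', s'⟩ h
    fin_cases s <;> fin_cases s' <;> simp [hJ] at h ⊢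
    · exact h
    · exact hne _ _ h
    · exact hne _ _ h.symm
    · have := congrArg φ h
      rw [(hφ _ (hτT t)).2.2.1, (hφ _ (hτT t')).2.2.1] at this
      exact τ.injective this
  obtain ⟨σ, hσ⟩ := exists_sum_equiv hJinj (e := d - 2 * splitNumber d k) (by
    rw [Fintype.card_prod, Fintype.card_fin, Fintype.card_fin, Fintype.card_fin, hd]; omega)
  have hσ0 : ∀ t, σ (Sum.inr (t, 0)) = τ t := fun t => by simp [hσ, hJ]
  have hσ1 : ∀ t, σ (Sum.inr (t, 1)) = φ (τ t) := fun t => by simp [hσ, hJ]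
  obtain ⟨Q, hQ, hPQ⟩ := exists_latticeEquivalent_freeSum b σ hP hX hV (fun t => by
      obtain ⟨h1, -, h3, h4, h5, -⟩ := hφ _ (hτT t)
      obtain ⟨-, -, -, h4', h5', -⟩ := hφ _ h1
      rw [h3] at h5'
      rw [hσ0, hσ1]
      exact ⟨hb.mem _, hb.mem _, h4, h4', h5, h5'⟩)
    (fun x hx t s hts => by
      obtain ⟨h1, -, h3, -, -, h6⟩ := hφ _ (hτT t)
      obtain ⟨-, -, -, -, -, h6'⟩ := hφ _ h1
      rw [h3] at h6'
      rw [hσ0, hσ1]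
      have h : b.repr x (τ t) ≠ 0 ∨ b.repr x (φ (τ t)) ≠ 0 := by
        fin_cases s
        · exact Or.inl (by rwa [← hσ0])
        · exact Or.inr (by rwa [← hσ1])
      rcases h with h | h
      · rcases h6 x hx h with h | h | h | h <;> simp [h]
      · rcases h6' x hx h with h | h | h | h <;> simp [h])
  exact ⟨_, Q, by omega, hQ, hPQ⟩
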